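/- **Setting.** Let $0<r_1<r_2<\infty$ and let $U:[r_1,r_2]\to\mathbb R$ be strictly monotone and differentiable, with $U'$ Lipschitz continuous and without zeros. Put $a=\min(U(r_1),U(r_2))$, $b=\max(U(r_1),U(r_2))$ and, for $y\in[a,b]$, $r(y)=U^{-1}(y)$, $g(y)=U'(U^{-1}(y))$. Let $k\in 2\pi(\mathbb Z\setminus\{0\})$, let $h:[a,b]\to\mathbb C$ be in $W^{1,\infty}$, and write $L^2=L^2([a,b];\mathbb C)$, $D_t=\frac{\partial_y}{k}-it$. * For $w\in L^2$ and $t\in\mathbb R$, $L_tw$ is the solution $\Phi$ of $\big((gD_t)^2+\frac{g}{kr}D_t-\frac1{r^2}\big)\Phi=w$ with $\Phi=0$ at $y=a,b$. * *Euler's equations in scattering formulation* are $\partial_tW=\frac{ih}{k}L_tW$ in $L^2$. * $\|u\|_{\tilde H^1_t}^2=\|u\|_{L^2}^2+\|D_tu\|_{L^2}^2$ for $u\in H^1([a,b])$, and $\|v\|_{\tilde H^{-1}_t}=\|\Psi\|_{\tilde H^1_t}$ for $v\in L^2$, where $\Psi$ is the solution of $(-1+D_t^2)\Psi=v$ with $\Psi=0$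 at $y=a,b$. * $A(t)$ is the Fourier multiplier $A(t)\sum_nu_ne_n=\sum_n\exp\big(\arctan(\tfrac nk-t)\big)u_ne_n$ on $L^2$, where $e_n=(b-a)^{-1/2}e^{iny}$ and $n$ runs through $\frac{2\pi}{b-a}\mathbb Z$. For fixed $u$, $\langle u,\dot A(t)u\rangle=\frac{d}{dt}\langle u,A(t)u\rangle$. **Constants.** Consider, for constants $C_2>0$ and $C>0$ and for the given $k$, the inequalities $$\text{(i)}\quad \|u\|_{\tilde H^{-1}_t}\|A(t)u\|_{\tilde H^{-1}_t}\le -C_2\langle u,\dot A(t)u\rangle,\qquad \text{(ii)}\quad \|L_tu\|_{\tilde H^1_t}\le \tfrac C2\|u\|_{\tilde H^{-1}_t}\qquad(u\in L^2,\ t\in\mathbb R).$$ There is an absolute constant $C_2\in[e^{-\pi},e^{\pi}]$ such that (i) holds for all $a<b$ and all $k\in2\pi(\mathbb Z\setminus\{0\})$, and for every $(r_1,r_2,U)$ as above there is a constant $C>0$ such that (ii) holds for all $k\in2\pi(\mathbb Z\setminus\{0\})$. **Theorem ($L^2$ stability).** Let $C_2>0$ and $C>0$ be any constants for which (i) and (ii)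 hold for the given $k$, and suppose that there is $\delta>0$ with $$|k|^{-1}\big(\|h\|_{L^\infty}+|k|^{-1}\|\partial_yh\|_{L^\infty}\big)\le\frac1C\Big(\frac1{C_2}-\delta\Big).$$ Then for every solution $W$ of Euler's equations in scattering formulation on a nondegenerate time interval $J\subset\mathbb R$, the functional $I(t)=\langle W(t),A(t)W(t)\rangle_{L^2}$ is differentiable and non-increasing on $J$, and $$\frac{d}{dt}I(t)\le-\delta\,\|W(t)\|_{\tilde H^{-1}_t}\|A(t)W(t)\|_{\tilde H^{-1}_t}\le0\qquad(t\in J).$$ In particular, if $0\in J$ and $\omega_0=W(0)$, then for all $t\in J$ with $t\ge0$ $$e^{-\pi}\|W(t)\|_{L^2}^2\le I(t)\le I(0)\le e^{\pi}\|\omega_0\|_{L^2}^2,\qquad\text{so that}\qquad \|W(t)\|_{L^2}\le e^{\pi}\|\omega_0\|_{L^2}.$$ -/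

import Mathlib

open MeasureTheory Set
open scoped ENNReal NNReal

noncomputable section

namespace EulerScattering

/-! ### Function spaces on the interval `[a, b]` -/

/-- Lebesgue measure on `[a, b]` (one endpoint is left out, which changes nothing). -/
abbrev intervalMeasure (a b : ℝ) : Measure ℝ := volume.restrict (Ioc a b)

/-- The complex Hilbert space `L²([a, b])`. -/
abbrev L2 (a b : ℝ) : Type := Lp ℂ 2 (intervalMeasure a b)

/-- `u ∈ H¹([a, b])`, through the continuous representative: `u` is the primitive on `[a, b]` of
its almost everywhere defined derivative, which lies in `L²`. -/
def IsH1 (a b : ℝ) (u : ℝ → ℂ) : Prop :=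
  MemLp (deriv u) 2 (intervalMeasure a b) ∧
    ∀ y ∈ Icc a b, u y = u a + ∫ s in a..y, deriv u s

/-- `u ∈ H¹₀([a, b])`. -/
def IsH10 (a b : ℝ) (u : ℝ → ℂ) : Prop :=
  IsH1 a b u ∧ u a = 0 ∧ u b = 0

/-- The shifted derivative `(∂_y / k - i t) u`. -/
def shiftedDeriv (k t : ℝ) (u : ℝ → ℂ) : ℝ → ℂ :=
  fun y => deriv u y / (k : ℂ) - Complex.I * (t : ℂ) * u y

/-- The `H̃¹_t` energy norm,
`‖u‖² = ‖u‖²_{L²} + ‖(∂_y / k - i t) u‖²_{L²}`. -/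
def hTildeNorm (a b k t : ℝ) (u : ℝ → ℂ) : ℝ :=
  Real.sqrt ((∫ y in a..b, ‖u y‖ ^ 2) + ∫ y in a..b, ‖shiftedDeriv k t u y‖ ^ 2)

/-- `ψ` solves `(-1 + (∂_y / k - i t)²) ψ = v` in `L²([a, b])` with `ψ = 0` at `a` and `b`.
The function `q` is the `H¹` representative of `(∂_y / k - i t) ψ`. -/
def IsDirichletPotential (a b k t : ℝ) (v ψ : ℝ → ℂ) : Prop :=
  IsH10 a b ψ ∧
    ∃ q : ℝ → ℂ, IsH1 a b q ∧
      (∀ᵐ y ∂(intervalMeasure a b), q y = shiftedDeriv k t ψ y) ∧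
      (∀ᵐ y ∂(intervalMeasure a b), -ψ y + shiftedDeriv k t q y = v y)

/-- `Ψ_t[v]`, the solution of `(-1 + (∂_y / k - i t)²) Ψ = v` with zero boundary values
(it exists, and is unique as a function on `[a, b]`, for every `v ∈ L²`). -/
def dirichletPotential (a b k t : ℝ) (v : ℝ → ℂ) : ℝ → ℂ :=
  Classical.epsilon (IsDirichletPotential a b k t v)

/-- The `H̃^{-1}_t` energy norm, `‖v‖_{H̃^{-1}_t} = ‖Ψ_t[v]‖_{H̃¹_t}`. -/
def hTildeNegNorm (a b k t : ℝ) (v : ℝ → ℂ) : ℝ :=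
  hTildeNorm a b k t (dirichletPotential a b k t v)

/-! ### The Fourier weight -/

/-- The frequencies `n ∈ (2π / (b - a)) ℤ`. -/
def freq (a b : ℝ) (m : ℤ) : ℝ := 2 * Real.pi * m / (b - a)

/-- The function `y ↦ (b - a)^{-1/2} e^{i n y}` with `n = freq a b m`. -/
def modeFun (a b : ℝ) (m : ℤ) : ℝ → ℂ :=
  fun y => Complex.exp (Complex.I * ((freq a b m * y : ℝ) : ℂ)) / ((Real.sqrt (b - a) : ℝ) : ℂ)

theorem memLp_modeFun (a b : ℝ) (m : ℤ) : MemLp (modeFun a b m) 2 (intervalMeasure a b) := by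
  have hc : Continuous (modeFun a b m) := by
    unfold modeFun
    fun_prop
  refine MemLp.of_bound hc.aestronglyMeasurable (1 / Real.sqrt (b - a)) ?_
  refine Filter.Eventually.of_forall fun y => ?_
  unfold modeFun
  rw [norm_div, mul_comm Complex.I, Complex.norm_exp_ofReal_mul_I, Complex.norm_real,
    Real.norm_of_nonneg (Real.sqrt_nonneg _)]

/-- The orthonormal Fourier basis of `L²([a, b])`. -/
def mode (a b : ℝ) (m : ℤ) : L2 a b := (memLp_modeFun a b m).toLp

/-- The weight `A(t)`: the Fourier multiplier `exp (arctan (n / k - t))`, that is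
`A(t) ∑ uₙ eₙ = ∑ exp (arctan (n / k - t)) uₙ eₙ`. -/
def weightOp (a b k t : ℝ) (u : L2 a b) : L2 a b :=
  ∑' m : ℤ, (((Real.exp (Real.arctan (freq a b m / k - t)) : ℝ) : ℂ) *
    inner ℂ (mode a b m) u) • mode a b m

/-- The quadratic form `⟨u, A(t) u⟩` (a real number, since `A(t)` is symmetric). -/
def weightForm (a b k t : ℝ) (u : L2 a b) : ℝ :=
  (inner ℂ u (weightOp a b k t u)).re

/-- `C₂` satisfies `‖u‖_{H̃^{-1}_t} ‖A(t) u‖_{H̃^{-1}_t} ≤ -C₂ ⟨u, Ȧ(t) u⟩` for all `u` and `t`,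
where `⟨u, Ȧ(t) u⟩` is the time derivative of `⟨u, A(t) u⟩` for fixed `u`. -/
def IsWeightConstant (a b k C₂ : ℝ) : Prop :=
  ∀ (t : ℝ) (u : L2 a b),
    hTildeNegNorm a b k t u * hTildeNegNorm a b k t (weightOp a b k t u) ≤
      -C₂ * deriv (fun s => weightForm a b k s u) t

/-! ### The angular velocity and the scattering formulation -/

/-- Wave numbers `k ∈ 2π (ℤ \ {0})`. -/
def IsWaveNumber (k : ℝ) : Prop := ∃ m : ℤ, m ≠ 0 ∧ k = 2 * Real.pi * m

/-- `U : [r₁, r₂] → ℝ`, `0 < r₁ < r₂`, is strictly monotone, with a Lipschitz continuous derivative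
that has no zero; so `U` is bilipschitz and `g = U' ∘ U⁻¹` is in `W^{1,∞}`. -/
structure IsAngularVelocity (r₁ r₂ : ℝ) (U : ℝ → ℝ) : Prop where
  pos : 0 < r₁
  lt : r₁ < r₂
  strictMono_or_strictAnti : StrictMonoOn U (Icc r₁ r₂) ∨ StrictAntiOn U (Icc r₁ r₂)
  differentiableOn : DifferentiableOn ℝ U (Icc r₁ r₂)
  lipschitz_deriv : ∃ K : ℝ≥0, LipschitzOnWith K (derivWithin U (Icc r₁ r₂)) (Icc r₁ r₂)
  deriv_ne_zero : ∀ r ∈ Icc r₁ r₂, derivWithin U (Icc r₁ r₂) r ≠ 0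

/-- Left endpoint `a` of the range `[a, b]` of `U`. -/
def leftEnd (r₁ r₂ : ℝ) (U : ℝ → ℝ) : ℝ := min (U r₁) (U r₂)

/-- Right endpoint `b` of the range `[a, b]` of `U`. -/
def rightEnd (r₁ r₂ : ℝ) (U : ℝ → ℝ) : ℝ := max (U r₁) (U r₂)

/-- `r(y) = U⁻¹(y)`. -/
def radius (r₁ r₂ : ℝ) (U : ℝ → ℝ) (y : ℝ) : ℝ := Function.invFunOn U (Icc r₁ r₂) y

/-- `g(y) = U'(U⁻¹(y))`. -/
def gCoeff (r₁ r₂ : ℝ) (U : ℝ → ℝ) (y : ℝ) : ℝ :=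
  derivWithin U (Icc r₁ r₂) (radius r₁ r₂ U y)

/-- `Φ = L_t w`: the function `Φ` solves
`((g (∂_y / k - i t))² + g / (k r) (∂_y / k - i t) - 1 / r²) Φ = w` in `L²([a, b])` with `Φ = 0` at
`a` and `b`. The function `p` is the `H¹` representative of `g (∂_y / k - i t) Φ`. -/
def IsStreamFunction (a b : ℝ) (g r : ℝ → ℝ) (k t : ℝ) (w Φ : ℝ → ℂ) : Prop :=
  IsH10 a b Φ ∧
    ∃ p : ℝ → ℂ, IsH1 a b p ∧
      (∀ᵐ y ∂(intervalMeasure a b), p y = (g y : ℂ) * shiftedDeriv k t Φ y) ∧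
      (∀ᵐ y ∂(intervalMeasure a b),
        (g y : ℂ) * shiftedDeriv k t p y
          + (g y : ℂ) / ((k : ℂ) * (r y : ℂ)) * shiftedDeriv k t Φ y
          - 1 / (r y : ℂ) ^ 2 * Φ y = w y)

/-- `K` satisfies `‖L_t w‖_{H̃¹_t} ≤ K ‖w‖_{H̃^{-1}_t}` for all `w ∈ L²` and all `t`. -/
def IsEllipticConstant (a b : ℝ) (g r : ℝ → ℝ) (k K : ℝ) : Prop :=
  ∀ (t : ℝ) (w : L2 a b) (Φ : ℝ → ℂ), IsStreamFunction a b g r k t w Φ →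
    hTildeNorm a b k t Φ ≤ K * hTildeNegNorm a b k t w

/-- `W` solves Euler's equations in scattering formulation, `∂_t W = (i h / k) L_t W` in
`L²([a, b])`, on the time interval `J`. -/
def IsScatteringSolution (a b : ℝ) (g r : ℝ → ℝ) (h : ℝ → ℂ) (k : ℝ) (J : Set ℝ)
    (W : ℝ → L2 a b) : Prop :=
  ∀ t ∈ J, ∃ (Φ : ℝ → ℂ) (V : L2 a b),
    IsStreamFunction a b g r k t (W t) Φ ∧
      (∀ᵐ y ∂(intervalMeasure a b), V y = Complex.I * h y / (k : ℂ) * Φ y) ∧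
      HasDerivWithinAt W V J t

/-- The `L^∞([a, b])` norm. -/
def supNorm (a b : ℝ) (f : ℝ → ℂ) : ℝ := (eLpNorm f ∞ (intervalMeasure a b)).toReal

end EulerScattering

end

open EulerScattering

/-
The symbol of `A(t)` decreases in time, so `-⟨u, Ȧ(t) u⟩` is nonnegative: in Fourier variables it
carries the weight `exp (arctan ξ) / (1 + ξ²)` with `ξ = n / k - t`, which by Parseval is also what
bounds `‖u‖²` and `‖A(t) u‖²` in `H̃^{-1}_t`. The forcing is the pairing of `h Φ ∈ H¹₀` with
`A(t) W`; it is estimated by the duality of `H̃¹_t` and `H̃^{-1}_t`, by the Leibniz rule for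
multiplication with `h`, and by the elliptic estimate for `Φ = L_t W`, so that for small `h` the
dissipation wins. The elliptic estimate comes from testing the equation of `Φ` with `(r / g) Φ`:
since `r' = 1 / g`, the first order term drops out and an energy with weights `r g` and `1 / (r g)`
remains, which has a sign.
-/

namespace EulerScattering

section AbsolutelyContinuous

theorem absolutelyContinuousOnInterval_of_dist_le {X Y : Type*} [PseudoMetricSpace X]
    [PseudoMetricSpace Y] {u : ℝ → X} {v : ℝ → Y} {a b K : ℝ}
    (hv : AbsolutelyContinuousOnInterval v a b)
    (h : ∀ x ∈ uIcc a b, ∀ y ∈ uIcc a b, dist (u x) (u y) ≤ K * dist (v x) (v y)) :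
    AbsolutelyContinuousOnInterval u a b := by
  have hKv : Filter.Tendsto (fun E : ℕ × (ℕ → ℝ × ℝ) =>
      K * ∑ i ∈ Finset.range E.1, dist (v (E.2 i).1) (v (E.2 i).2))
      (AbsolutelyContinuousOnInterval.totalLengthFilter ⊓
        Filter.principal (AbsolutelyContinuousOnInterval.disjWithin a b)) (nhds 0) := by
    simpa using Filter.Tendsto.const_mul K hv
  refine squeeze_zero' (.of_forall fun _ => Finset.sum_nonneg fun _ _ => dist_nonneg)
    (Filter.mem_inf_of_right fun E hE => ?_) hKv
  rw [mem_ofPred_eq, Finset.mul_sum]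
  exact Finset.sum_le_sum fun i hi => h _ (hE.1 i hi).1 _ (hE.1 i hi).2

variable {E : Type*} [NormedAddCommGroup E] [NormedSpace ℝ E] {a b : ℝ} {f u : ℝ → E}

theorem absolutelyContinuousOnInterval_integral (hf : IntervalIntegrable f volume a b) :
    AbsolutelyContinuousOnInterval (fun y => ∫ s in a..y, f s) a b := by
  refine absolutelyContinuousOnInterval_of_dist_le (K := 1)
    (hf.norm.absolutelyContinuousOnInterval_intervalIntegral (c := a) left_mem_uIcc)
    fun x hx y hy => ?_
  have hi : ∀ z ∈ uIcc a b, IntervalIntegrable f volume a z := fun z hz =>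
    hf.mono_set (uIcc_subset_uIcc_left hz)
  rw [one_mul, dist_comm, dist_comm (∫ s in a..x, ‖f s‖), dist_eq_norm, Real.dist_eq,
    intervalIntegral.integral_interval_sub_left (hi y hy) (hi x hx),
    intervalIntegral.integral_interval_sub_left (hi y hy).norm (hi x hx).norm]
  exact intervalIntegral.norm_integral_le_abs_integral_norm

variable [CompleteSpace E]

theorem integral_eq_sub_of_ae_hasDerivAt (hu : AbsolutelyContinuousOnInterval u a b)
    (hf : IntervalIntegrable f volume a b)
    (h : ∀ᵐ y, y ∈ uIcc a b → HasDerivAt u (f y) y) :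
    ∫ y in a..b, f y = u b - u a := by
  have hd : ∀ᵐ y, y ∈ uIcc a b → HasDerivAt (u - fun y => ∫ s in a..y, f s) 0 y := by
    filter_upwards [h, hf.ae_hasDerivAt_integral] with y hu hF hy
    simpa using (hu hy).sub (hF hy a left_mem_uIcc)
  obtain ⟨c, hc⟩ :=
    (hu.sub (absolutelyContinuousOnInterval_integral hf)).const_of_ae_hasDerivAt_zero hd
  have := (hc a left_mem_uIcc).trans (hc b right_mem_uIcc).symm
  simp only [Pi.sub_apply, intervalIntegral.integral_same, sub_zero] at this
  rw [this, sub_sub_cancel]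

end AbsolutelyContinuous

section Sobolev

variable {a b : ℝ} {f m q u v φ : ℝ → ℂ}

theorem ae_mem_Ioo (a b : ℝ) : ∀ᵐ y ∂(intervalMeasure a b), y ∈ Ioo a b := by
  rw [intervalMeasure, ← restrict_Ioo_eq_restrict_Ioc]
  exact ae_restrict_mem measurableSet_Ioo

theorem intervalIntegrable_of_memLp_two (hab : a ≤ b) (hf : MemLp f 2 (intervalMeasure a b)) :
    IntervalIntegrable f volume a b :=
  (intervalIntegrable_iff_integrableOn_Ioc_of_le hab).2 (hf.integrable one_le_two)

theorem ae_hasDerivAt_integral (hab : a ≤ b) (hf : MemLp f 2 (intervalMeasure a b)) :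
    ∀ᵐ y ∂(intervalMeasure a b), HasDerivAt (fun x => ∫ s in a..x, f s) (f y) y := by
  filter_upwards [ae_mem_Ioo a b,
    ae_restrict_of_ae (intervalIntegrable_of_memLp_two hab hf).ae_hasDerivAt_integral] with y hy h
  exact h (uIcc_of_le hab ▸ Ioo_subset_Icc_self hy) a left_mem_uIcc

theorem isH1_of_ae_hasDerivAt (hu : AbsolutelyContinuousOnInterval u a b)
    (hf : MemLp f 2 (intervalMeasure a b))
    (h : ∀ᵐ y ∂(intervalMeasure a b), HasDerivAt u (f y) y) : IsH1 a b u := by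
  have hu' : MemLp (deriv u) 2 (intervalMeasure a b) :=
    hf.ae_eq (h.mono fun y hy => hy.deriv.symm)
  refine ⟨hu', fun y hy => ?_⟩
  have hay : Icc a y ⊆ Icc a b := Icc_subset_Icc_right hy.2
  have hd : ∀ᵐ x, x ∈ uIcc a y → HasDerivAt u (deriv u x) x := by
    rw [uIcc_of_le hy.1, ← ae_restrict_iff' measurableSet_Icc,
      ← restrict_Ioc_eq_restrict_Icc]
    exact ae_mono (Measure.restrict_mono_set _ (Ioc_subset_Ioc_right hy.2))
      (h.mono fun x hx => hx.differentiableAt.hasDerivAt)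
  rw [integral_eq_sub_of_ae_hasDerivAt
    (hu.mono (by rwa [uIcc_of_le hy.1, uIcc_of_le (hy.1.trans hy.2)]))
    ((intervalIntegrable_of_memLp_two (hy.1.trans hy.2) hu').mono_set
      (by rwa [uIcc_of_le hy.1, uIcc_of_le (hy.1.trans hy.2)])) hd]
  ring

theorem IsH1.ae_hasDerivAt (hab : a ≤ b) (hu : IsH1 a b u) :
    ∀ᵐ y ∂(intervalMeasure a b), HasDerivAt u (deriv u y) y := by
  filter_upwards [ae_mem_Ioo a b, ae_hasDerivAt_integral hab hu.1] with y hy h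
  refine (h.const_add (u a)).congr_of_eventuallyEq ?_
  filter_upwards [Icc_mem_nhds hy.1 hy.2] with x hx using hu.2 x hx

theorem IsH1.absolutelyContinuousOnInterval (hab : a ≤ b) (hu : IsH1 a b u) :
    AbsolutelyContinuousOnInterval u a b := by
  refine absolutelyContinuousOnInterval_of_dist_le (K := 1)
    (absolutelyContinuousOnInterval_integral (intervalIntegrable_of_memLp_two hab hu.1))
    fun x hx y hy => ?_
  rw [uIcc_of_le hab] at hx hy
  rw [hu.2 x hx, hu.2 y hy, dist_add_left, one_mul]

theorem IsH1.memLp_top (hab : a ≤ b) (hu : IsH1 a b u) : MemLp u ∞ (intervalMeasure a b) := by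
  have hac := hu.absolutelyContinuousOnInterval hab
  obtain ⟨C, hC⟩ := hac.exists_bound
  have hsub : Ioc a b ⊆ uIcc a b := uIcc_of_le hab ▸ Ioc_subset_Icc_self
  exact memLp_top_of_bound
    ((hac.continuousOn.mono hsub).aestronglyMeasurable measurableSet_Ioc) C
    ((ae_restrict_mem measurableSet_Ioc).mono fun x hx => hC x (hsub hx))

theorem IsH1.memLp (hab : a ≤ b) (hu : IsH1 a b u) : MemLp u 2 (intervalMeasure a b) :=
  (hu.memLp_top hab).mono_exponent le_top

theorem isH1_integral (hab : a ≤ b) (hf : MemLp f 2 (intervalMeasure a b)) :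
    IsH1 a b (fun y => ∫ s in a..y, f s) :=
  isH1_of_ae_hasDerivAt
    (absolutelyContinuousOnInterval_integral (intervalIntegrable_of_memLp_two hab hf)) hf
    (ae_hasDerivAt_integral hab hf)

theorem ae_norm_deriv_le_of_lipschitzOnWith {K : ℝ≥0} (hm : LipschitzOnWith K m (Icc a b)) :
    ∀ᵐ y ∂(intervalMeasure a b), ‖deriv m y‖ ≤ K := by
  filter_upwards [ae_mem_Ioo a b] with y hy
  exact norm_deriv_le_of_lipschitzOn (Icc_mem_nhds hy.1 hy.2) hm

theorem isH1_of_lipschitzOnWith {K : ℝ≥0} (hab : a ≤ b) (hm : LipschitzOnWith K m (Icc a b)) :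
    IsH1 a b m := by
  refine isH1_of_ae_hasDerivAt
    (LipschitzOnWith.absolutelyContinuousOnInterval (K := K) (by rwa [uIcc_of_le hab]))
    (MemLp.of_bound (stronglyMeasurable_deriv m).aestronglyMeasurable K
      (ae_norm_deriv_le_of_lipschitzOnWith hm)) ?_
  filter_upwards [ae_mem_Ioo a b, ae_restrict_of_ae hm.ae_differentiableWithinAt_of_mem_real]
    with y hy h
  exact ((h (Ioo_subset_Icc_self hy)).differentiableAt (Icc_mem_nhds hy.1 hy.2)).hasDerivAt

theorem IsH1.mul (hab : a ≤ b) (hu : IsH1 a b u) (hv : IsH1 a b v) :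
    IsH1 a b (fun y => u y * v y) := by
  refine isH1_of_ae_hasDerivAt (f := fun y => deriv u y * v y + u y * deriv v y)
    ((hu.absolutelyContinuousOnInterval hab).smul (hv.absolutelyContinuousOnInterval hab))
    (((hv.memLp_top hab).mul hu.1).add (hv.1.mul (hu.memLp_top hab))) ?_
  filter_upwards [hu.ae_hasDerivAt hab, hv.ae_hasDerivAt hab] with y hu hv using hu.mul hv

theorem IsH1.add (hab : a ≤ b) (hu : IsH1 a b u) (hv : IsH1 a b v) :
    IsH1 a b (fun y => u y + v y) := by
  refine isH1_of_ae_hasDerivAt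
    ((hu.absolutelyContinuousOnInterval hab).add (hv.absolutelyContinuousOnInterval hab))
    (hu.1.add hv.1) ?_
  filter_upwards [hu.ae_hasDerivAt hab, hv.ae_hasDerivAt hab] with y hu hv using hu.add hv

theorem IsH1.const_mul (c : ℂ) (hu : IsH1 a b u) : IsH1 a b (fun y => c * u y) := by
  refine ⟨?_, fun y hy => ?_⟩
  · simpa only [deriv_const_mul_field'] using hu.1.const_mul c
  · simp only [deriv_const_mul_field']
    rw [intervalIntegral.integral_const_mul, hu.2 y hy, mul_add]

theorem IsH1.star (hab : a ≤ b) (hu : IsH1 a b u) : IsH1 a b (fun y => star (u y)) := by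
  refine isH1_of_ae_hasDerivAt
    (absolutelyContinuousOnInterval_of_dist_le (K := 1) (hu.absolutelyContinuousOnInterval hab)
      fun x _ y _ => by rw [one_mul]; exact (Complex.dist_conj_conj _ _).le)
    hu.1.star ?_
  filter_upwards [hu.ae_hasDerivAt hab] with y hy using hy.star

theorem IsH1.memLp_shiftedDeriv (hab : a ≤ b) (hu : IsH1 a b u) (k t : ℝ) :
    MemLp (shiftedDeriv k t u) 2 (intervalMeasure a b) := by
  have h : MemLp (fun y => deriv u y / (k : ℂ)) 2 (intervalMeasure a b) := by
    simpa only [div_eq_inv_mul] using hu.1.const_mul (k : ℂ)⁻¹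
  exact h.sub ((hu.memLp hab).const_mul (Complex.I * t))

theorem IsH10.mul_left (hab : a ≤ b) (hm : IsH1 a b m) (hu : IsH10 a b u) :
    IsH10 a b (fun y => m y * u y) :=
  ⟨hm.mul hab hu.1, by simp [hu.2.1], by simp [hu.2.2]⟩

theorem shiftedDeriv_mul (hab : a ≤ b) (hm : IsH1 a b m) (hu : IsH1 a b u) (k t : ℝ) :
    ∀ᵐ y ∂(intervalMeasure a b), shiftedDeriv k t (fun y => m y * u y) y =
      m y * shiftedDeriv k t u y + deriv m y / (k : ℂ) * u y := by
  filter_upwards [hm.ae_hasDerivAt hab, hu.ae_hasDerivAt hab] with y hm hu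
  rw [shiftedDeriv, (hm.fun_mul hu).deriv, shiftedDeriv]
  ring

theorem shiftedDeriv_add (hab : a ≤ b) (hu : IsH1 a b u) (hv : IsH1 a b v) (k t : ℝ) :
    ∀ᵐ y ∂(intervalMeasure a b), shiftedDeriv k t (fun y => u y + v y) y =
      shiftedDeriv k t u y + shiftedDeriv k t v y := by
  filter_upwards [hu.ae_hasDerivAt hab, hv.ae_hasDerivAt hab] with y hu hv
  rw [shiftedDeriv, (hu.fun_add hv).deriv, shiftedDeriv, shiftedDeriv]
  ring

theorem shiftedDeriv_const_mul (k t : ℝ) (c : ℂ) (u : ℝ → ℂ) (y : ℝ) :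
    shiftedDeriv k t (fun y => c * u y) y = c * shiftedDeriv k t u y := by
  simp only [shiftedDeriv, deriv_const_mul_field']
  ring

theorem integrable_conj_mul (hu : MemLp u 2 (intervalMeasure a b))
    (hv : MemLp v 2 (intervalMeasure a b)) :
    Integrable (fun y => star (u y) * v y) (intervalMeasure a b) :=
  hu.star.integrable_mul hv

theorem integral_deriv_eq_zero (hab : a ≤ b) (hu : IsH10 a b u) :
    ∫ y, deriv u y ∂(intervalMeasure a b) = 0 := by
  have h := hu.1.2 b (right_mem_Icc.2 hab)
  rwa [hu.2.1, hu.2.2, zero_add, intervalIntegral.integral_of_le hab, eq_comm] at h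

theorem integral_conj_mul_shiftedDeriv (hab : a ≤ b) (hφ : IsH10 a b φ) (hq : IsH1 a b q)
    (k t : ℝ) :
    ∫ y, star (φ y) * shiftedDeriv k t q y ∂(intervalMeasure a b) =
      -∫ y, star (shiftedDeriv k t φ y) * q y ∂(intervalMeasure a b) := by
  have hφ' : IsH10 a b (fun y => star (φ y)) :=
    ⟨hφ.1.star hab, by simp [hφ.2.1], by simp [hφ.2.2]⟩
  have hprod : IsH10 a b (fun y => (k : ℂ)⁻¹ * (star (φ y) * q y)) :=
    ⟨(hφ'.1.mul hab hq).const_mul _, by simp [hφ.2.1], by simp [hφ.2.2]⟩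
  rw [eq_neg_iff_add_eq_zero, ← integral_add
    (integrable_conj_mul (hφ.1.memLp hab) (hq.memLp_shiftedDeriv hab k t))
    (integrable_conj_mul (hφ.1.memLp_shiftedDeriv hab k t) (hq.memLp hab)),
    ← integral_deriv_eq_zero hab hprod]
  refine integral_congr_ae ?_
  filter_upwards [hφ.1.ae_hasDerivAt hab, hq.ae_hasDerivAt hab] with y hφ hq
  rw [((hφ.star.fun_mul hq).const_mul (k : ℂ)⁻¹).deriv]
  simp only [shiftedDeriv, star_sub,
    star_mul', star_div₀, Complex.star_def, Complex.conj_ofReal, Complex.conj_I]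
  ring

end Sobolev

section Energy

variable {α : Type*} [MeasurableSpace α] {μ : Measure α} {f g : α → ℂ}

theorem inner_toLp (hf : MemLp f 2 μ) (hg : MemLp g 2 μ) :
    inner ℂ (hf.toLp f) (hg.toLp g) = ∫ y, star (f y) * g y ∂μ := by
  rw [L2.inner_def]
  refine integral_congr_ae ?_
  filter_upwards [hf.coeFn_toLp, hg.coeFn_toLp] with y h1 h2
  rw [h1, h2, RCLike.inner_apply', Complex.star_def]

theorem integral_conj_mul_self (f : α → ℂ) :
    ∫ y, star (f y) * f y ∂μ = ((∫ y, ‖f y‖ ^ 2 ∂μ : ℝ) : ℂ) := by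
  simp only [Complex.star_def, Complex.conj_mul', ← Complex.ofReal_pow]
  exact integral_ofReal

theorem norm_toLp_sq (hf : MemLp f 2 μ) : ‖hf.toLp f‖ ^ 2 = ∫ y, ‖f y‖ ^ 2 ∂μ := by
  rw [← inner_self_eq_norm_sq (𝕜 := ℂ), inner_toLp, integral_conj_mul_self]
  exact Complex.ofReal_re _

theorem norm_toLp_le_mul_norm_toLp {c : ℝ} (hf : MemLp f 2 μ) (hg : MemLp g 2 μ)
    (h : ∀ᵐ y ∂μ, ‖f y‖ ≤ c * ‖g y‖) : ‖hf.toLp f‖ ≤ c * ‖hg.toLp g‖ := by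
  refine Lp.norm_le_mul_norm_of_ae_le_mul ?_
  filter_upwards [hf.coeFn_toLp, hg.coeFn_toLp, h] with y h1 h2 h
  rwa [h1, h2]

variable {a b : ℝ} {m u φ ψ : ℝ → ℂ}

theorem hTildeNorm_nonneg (a b k t : ℝ) (u : ℝ → ℂ) : 0 ≤ hTildeNorm a b k t u :=
  Real.sqrt_nonneg _

theorem hTildeNegNorm_nonneg (a b k t : ℝ) (v : ℝ → ℂ) : 0 ≤ hTildeNegNorm a b k t v :=
  hTildeNorm_nonneg ..

theorem sq_hTildeNorm (hab : a ≤ b) (k t : ℝ) (u : ℝ → ℂ) :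
    hTildeNorm a b k t u ^ 2 = (∫ y, ‖u y‖ ^ 2 ∂(intervalMeasure a b)) +
      ∫ y, ‖shiftedDeriv k t u y‖ ^ 2 ∂(intervalMeasure a b) := by
  rw [hTildeNorm, intervalIntegral.integral_of_le hab, intervalIntegral.integral_of_le hab,
    Real.sq_sqrt (by positivity)]

theorem IsH1.sq_hTildeNorm_eq_norm_toLp (hab : a ≤ b) (hu : IsH1 a b u) (k t : ℝ) :
    hTildeNorm a b k t u ^ 2 = ‖(hu.memLp hab).toLp u‖ ^ 2 +
      ‖(hu.memLp_shiftedDeriv hab k t).toLp (shiftedDeriv k t u)‖ ^ 2 := by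
  rw [sq_hTildeNorm hab, norm_toLp_sq, norm_toLp_sq]

theorem norm_energy_inner_le (hab : a ≤ b) (hφ : IsH1 a b φ) (hψ : IsH1 a b ψ) (k t : ℝ) :
    ‖(∫ y, star (φ y) * ψ y ∂(intervalMeasure a b)) +
      ∫ y, star (shiftedDeriv k t φ y) * shiftedDeriv k t ψ y ∂(intervalMeasure a b)‖ ≤
      hTildeNorm a b k t φ * hTildeNorm a b k t ψ := by
  rw [← inner_toLp (hφ.memLp hab) (hψ.memLp hab),
    ← inner_toLp (hφ.memLp_shiftedDeriv hab k t) (hψ.memLp_shiftedDeriv hab k t)]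
  refine (norm_add_le _ _).trans
    ((add_le_add (norm_inner_le_norm _ _) (norm_inner_le_norm _ _)).trans ?_)
  refine le_of_sq_le_sq ?_ (mul_nonneg (hTildeNorm_nonneg ..) (hTildeNorm_nonneg ..))
  rw [mul_pow, hφ.sq_hTildeNorm_eq_norm_toLp hab, hψ.sq_hTildeNorm_eq_norm_toLp hab]
  generalize ‖(hφ.memLp hab).toLp φ‖ = x₁, ‖(hψ.memLp hab).toLp ψ‖ = x₂,
    ‖(hφ.memLp_shiftedDeriv hab k t).toLp _‖ = y₁, ‖(hψ.memLp_shiftedDeriv hab k t).toLp _‖ = y₂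
  linear_combination sq_nonneg (x₁ * y₂ - x₂ * y₁)

theorem norm_shiftedDeriv_mul_le {M₀ M₁ : ℝ} (hab : a ≤ b) (hm : IsH1 a b m) (hu : IsH1 a b u)
    (k t : ℝ) (h₀ : ∀ᵐ y ∂(intervalMeasure a b), ‖m y‖ ≤ M₀)
    (h₁ : ∀ᵐ y ∂(intervalMeasure a b), ‖deriv m y‖ ≤ M₁) :
    ‖((hm.mul hab hu).memLp_shiftedDeriv hab k t).toLp (shiftedDeriv k t fun y => m y * u y)‖ ≤
      M₀ * ‖(hu.memLp_shiftedDeriv hab k t).toLp (shiftedDeriv k t u)‖ +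
        |k|⁻¹ * M₁ * ‖(hu.memLp hab).toLp u‖ := by
  have hmD : MemLp (fun y => m y * shiftedDeriv k t u y) 2 (intervalMeasure a b) :=
    (hu.memLp_shiftedDeriv hab k t).mul (hm.memLp_top hab)
  have hm'u : MemLp (fun y => deriv m y / (k : ℂ) * u y) 2 (intervalMeasure a b) := by
    simp only [div_eq_inv_mul]
    exact (hu.memLp_top hab).mul (hm.1.const_mul (k : ℂ)⁻¹)
  rw [MemLp.toLp_congr _ (hmD.add hm'u) (shiftedDeriv_mul hab hm hu k t),
    MemLp.toLp_add hmD hm'u]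
  refine (norm_add_le _ _).trans (add_le_add (norm_toLp_le_mul_norm_toLp _ _ ?_)
    (norm_toLp_le_mul_norm_toLp _ _ ?_))
  · filter_upwards [h₀] with y hy
    rw [norm_mul]
    gcongr
  · filter_upwards [h₁] with y hy
    rw [norm_mul, norm_div, Complex.norm_real, Real.norm_eq_abs, div_eq_inv_mul]
    gcongr

theorem hTildeNorm_mul_le {M₀ M₁ : ℝ} (hab : a ≤ b) (hm : IsH1 a b m) (hu : IsH1 a b u)
    (k t : ℝ) (hM₀ : 0 ≤ M₀) (hM₁ : 0 ≤ M₁)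
    (h₀ : ∀ᵐ y ∂(intervalMeasure a b), ‖m y‖ ≤ M₀)
    (h₁ : ∀ᵐ y ∂(intervalMeasure a b), ‖deriv m y‖ ≤ M₁) :
    hTildeNorm a b k t (fun y => m y * u y) ≤ (M₀ + |k|⁻¹ * M₁) * hTildeNorm a b k t u := by
  have hmu : ‖((hm.mul hab hu).memLp hab).toLp (fun y => m y * u y)‖ ≤
      M₀ * ‖(hu.memLp hab).toLp u‖ := by
    refine norm_toLp_le_mul_norm_toLp _ _ ?_
    filter_upwards [h₀] with y hy
    rw [norm_mul]
    gcongr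
  have hDmu := norm_shiftedDeriv_mul_le hab hm hu k t h₀ h₁
  refine le_of_sq_le_sq ?_ (mul_nonneg (by positivity) (hTildeNorm_nonneg ..))
  rw [mul_pow, (hm.mul hab hu).sq_hTildeNorm_eq_norm_toLp hab,
    hu.sq_hTildeNorm_eq_norm_toLp hab]
  refine (add_le_add (pow_le_pow_left₀ (norm_nonneg _) hmu 2)
    (pow_le_pow_left₀ (norm_nonneg _) hDmu 2)).trans ?_
  have hN : 0 ≤ |k|⁻¹ * M₁ := by positivity
  generalize |k|⁻¹ * M₁ = N at hN ⊢
  generalize ‖(hu.memLp hab).toLp u‖ = x, ‖(hu.memLp_shiftedDeriv hab k t).toLp _‖ = y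
  nlinarith [mul_nonneg (mul_nonneg hM₀ hN) (add_nonneg (sq_nonneg (x - y))
    (add_nonneg (sq_nonneg x) (sq_nonneg y))), mul_nonneg (sq_nonneg N) (sq_nonneg y)]

end Energy

section Dirichlet

variable {a b k t : ℝ} {f v p m φ ψ : ℝ → ℂ} {μ : ℂ}

/-- The solution of `u' = μ u + f`, `u(a) = c`, by variation of constants. -/
noncomputable def duhamel (a : ℝ) (μ : ℂ) (f : ℝ → ℂ) (c : ℂ) (y : ℝ) : ℂ :=
  Complex.exp (μ * (y - a)) * (c + ∫ s in a..y, Complex.exp (-μ * (s - a)) * f s)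

theorem hasDerivAt_cexp_mul_sub (a : ℝ) (μ : ℂ) (y : ℝ) :
    HasDerivAt (fun y : ℝ => Complex.exp (μ * (y - a))) (Complex.exp (μ * (y - a)) * μ) y := by
  simpa using (((hasDerivAt_id y).ofReal_comp.sub_const (a : ℂ)).const_mul μ).cexp

theorem isH1_cexp_mul_sub (hab : a ≤ b) (μ : ℂ) :
    IsH1 a b (fun y : ℝ => Complex.exp (μ * (y - a))) := by
  have hsmooth : ContDiff ℝ 1 (fun y : ℝ => Complex.exp (μ * (y - a))) := by
    have := Complex.ofRealCLM.contDiff (n := 1)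
    change ContDiff ℝ 1 (fun y : ℝ => (y : ℂ)) at this
    fun_prop
  obtain ⟨K, hK⟩ := hsmooth.contDiffOn.exists_lipschitzOnWith (s := Icc a b) one_ne_zero
    (convex_Icc _ _) isCompact_Icc
  exact isH1_of_lipschitzOnWith hab hK

theorem memLp_cexp_mul (hab : a ≤ b) (μ : ℂ) (hf : MemLp f 2 (intervalMeasure a b)) :
    MemLp (fun s : ℝ => Complex.exp (μ * (s - a)) * f s) 2 (intervalMeasure a b) :=
  hf.mul ((isH1_cexp_mul_sub hab μ).memLp_top hab)

theorem isH1_duhamel (hab : a ≤ b) (hf : MemLp f 2 (intervalMeasure a b)) (c : ℂ) :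
    IsH1 a b (duhamel a μ f c) :=
  (isH1_cexp_mul_sub hab μ).mul hab ((isH1_of_lipschitzOnWith hab
    (LipschitzWith.const c).lipschitzOnWith).add hab (isH1_integral hab (memLp_cexp_mul hab _ hf)))

theorem ae_hasDerivAt_duhamel (hab : a ≤ b) (hf : MemLp f 2 (intervalMeasure a b)) (c : ℂ) :
    ∀ᵐ y ∂(intervalMeasure a b), HasDerivAt (duhamel a μ f c) (μ * duhamel a μ f c y + f y) y := by
  filter_upwards [ae_hasDerivAt_integral hab (memLp_cexp_mul hab (-μ) hf)] with y hy
  refine ((hasDerivAt_cexp_mul_sub a μ y).fun_mul (hy.const_add c)).congr_deriv ?_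
  rw [← mul_assoc (Complex.exp _) (Complex.exp _), ← Complex.exp_add, neg_mul, add_neg_cancel,
    Complex.exp_zero, one_mul, duhamel]
  ring

theorem shiftedDeriv_duhamel (hab : a ≤ b) (hk : k ≠ 0) (t : ℝ)
    (hv : MemLp v 2 (intervalMeasure a b)) (c σ : ℂ) :
    ∀ᵐ y ∂(intervalMeasure a b),
      shiftedDeriv k t (duhamel a (k * (σ + Complex.I * t)) (fun y => k * v y) c) y =
        σ * duhamel a (k * (σ + Complex.I * t)) (fun y => k * v y) c y + v y := by
  filter_upwards [ae_hasDerivAt_duhamel hab (hv.const_mul (k : ℂ)) c] with y hy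
  have hk' : (k : ℂ) ≠ 0 := Complex.ofReal_ne_zero.2 hk
  rw [shiftedDeriv, hy.deriv]
  field_simp
  ring

/-- `-1 + D² = (D - 1) (D + 1)`: with `q = D ψ`, the functions `q ± ψ` solve first order
equations. -/
theorem isDirichletPotential_of_factors (hab : a ≤ b) (hp : IsH1 a b p) (hm : IsH1 a b m)
    (hpv : ∀ᵐ y ∂(intervalMeasure a b), shiftedDeriv k t p y = p y + v y)
    (hmv : ∀ᵐ y ∂(intervalMeasure a b), shiftedDeriv k t m y = -m y + v y)
    (ha : p a = m a) (hb : p b = m b) :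
    IsDirichletPotential a b k t v (fun y => 2⁻¹ * p y + -2⁻¹ * m y) := by
  have hp' := hp.const_mul 2⁻¹
  refine ⟨⟨hp'.add hab (hm.const_mul _), by simp only [ha]; ring, by simp only [hb]; ring⟩,
    fun y => 2⁻¹ * p y + 2⁻¹ * m y, hp'.add hab (hm.const_mul _), ?_, ?_⟩
  · filter_upwards [hpv, hmv, shiftedDeriv_add hab hp' (hm.const_mul (-2⁻¹)) k t] with y hp hm h
    rw [h, shiftedDeriv_const_mul, shiftedDeriv_const_mul, hp, hm]
    ring
  · filter_upwards [hpv, hmv, shiftedDeriv_add hab hp' (hm.const_mul 2⁻¹) k t] with y hp hm h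
    rw [h, shiftedDeriv_const_mul, shiftedDeriv_const_mul, hp, hm]
    ring

theorem cexp_mul_ne_cexp_mul {z w : ℂ} {x : ℝ} (hx : x ≠ 0) (h : z.re ≠ w.re) :
    Complex.exp (z * x) ≠ Complex.exp (w * x) := by
  intro he
  have hre := congrArg norm he
  rw [Complex.norm_exp, Complex.norm_exp, Real.exp_eq_exp, Complex.re_mul_ofReal,
    Complex.re_mul_ofReal] at hre
  exact h (mul_right_cancel₀ hx hre)

theorem exists_mul_add_eq_mul_add {𝕜 : Type*} [Field 𝕜] {x y : 𝕜} (h : x ≠ y) (α β : 𝕜) :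
    ∃ c, x * (c + α) = y * (c + β) := by
  refine ⟨(y * β - x * α) / (x - y), ?_⟩
  field_simp [sub_ne_zero.2 h]
  ring

theorem exists_isDirichletPotential (hab : a < b) (hk : k ≠ 0) (t : ℝ)
    (hv : MemLp v 2 (intervalMeasure a b)) : ∃ ψ, IsDirichletPotential a b k t v ψ := by
  set u : ℂ → ℂ → ℝ → ℂ := fun σ => duhamel a (k * (σ + Complex.I * t)) (fun y => k * v y)
  have hkv := hv.const_mul (k : ℂ)
  obtain ⟨c, hc⟩ : ∃ c, u 1 c b = u (-1) c b := by
    refine exists_mul_add_eq_mul_add ?_ _ _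
    have hre : (k * (1 + Complex.I * t) : ℂ).re ≠ (k * (-1 + Complex.I * t) : ℂ).re := by
      simp [self_eq_neg, hk]
    simpa only [Complex.ofReal_sub] using cexp_mul_ne_cexp_mul (sub_pos.2 hab).ne' hre
  refine ⟨_, isDirichletPotential_of_factors hab.le (isH1_duhamel hab.le hkv c)
    (isH1_duhamel hab.le hkv c) ?_ ?_ ?_ hc⟩
  · simpa only [one_mul] using shiftedDeriv_duhamel hab.le hk t hv c 1
  · simpa only [neg_one_mul] using shiftedDeriv_duhamel hab.le hk t hv c (-1)
  · simp [duhamel]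

theorem isDirichletPotential_dirichletPotential (hab : a < b) (hk : k ≠ 0) (t : ℝ)
    (hv : MemLp v 2 (intervalMeasure a b)) :
    IsDirichletPotential a b k t v (dirichletPotential a b k t v) :=
  Classical.epsilon_spec (exists_isDirichletPotential hab hk t hv)

theorem IsDirichletPotential.integral_conj_mul (hab : a ≤ b)
    (h : IsDirichletPotential a b k t v ψ) (hφ : IsH10 a b φ) :
    ∫ y, star (φ y) * v y ∂(intervalMeasure a b) =
      -((∫ y, star (φ y) * ψ y ∂(intervalMeasure a b)) +
        ∫ y, star (shiftedDeriv k t φ y) * shiftedDeriv k t ψ y ∂(intervalMeasure a b)) := by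
  obtain ⟨hψ, q, hq, hqψ, hv⟩ := h
  have hφ2 := hφ.1.memLp hab
  calc ∫ y, star (φ y) * v y ∂(intervalMeasure a b)
      = ∫ y, (star (φ y) * shiftedDeriv k t q y - star (φ y) * ψ y) ∂(intervalMeasure a b) :=
        integral_congr_ae (hv.mono fun y hy => by simp only [← hy]; ring)
    _ = -(∫ y, star (shiftedDeriv k t φ y) * q y ∂(intervalMeasure a b)) -
          ∫ y, star (φ y) * ψ y ∂(intervalMeasure a b) := by
        rw [integral_sub (integrable_conj_mul hφ2 (hq.memLp_shiftedDeriv hab k t))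
          (integrable_conj_mul hφ2 (hψ.1.memLp hab)), integral_conj_mul_shiftedDeriv hab hφ hq]
    _ = -(∫ y, star (shiftedDeriv k t φ y) * shiftedDeriv k t ψ y ∂(intervalMeasure a b)) -
          ∫ y, star (φ y) * ψ y ∂(intervalMeasure a b) := by
        congr 2
        exact integral_congr_ae (hqψ.mono fun y hy => by simp only [hy])
    _ = _ := by ring

theorem norm_integral_conj_mul_le (hab : a < b) (hk : k ≠ 0) (t : ℝ)
    (hv : MemLp v 2 (intervalMeasure a b)) (hφ : IsH10 a b φ) :
    ‖∫ y, star (φ y) * v y ∂(intervalMeasure a b)‖ ≤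
      hTildeNorm a b k t φ * hTildeNegNorm a b k t v := by
  have h := isDirichletPotential_dirichletPotential hab hk t hv
  rw [h.integral_conj_mul hab.le hφ, norm_neg]
  exact norm_energy_inner_le hab.le hφ.1 h.1.1 k t

theorem integral_conj_dirichletPotential_mul (hab : a < b) (hk : k ≠ 0) (t : ℝ)
    (hv : MemLp v 2 (intervalMeasure a b)) :
    ∫ y, star (dirichletPotential a b k t v y) * v y ∂(intervalMeasure a b) =
      -((hTildeNegNorm a b k t v ^ 2 : ℝ) : ℂ) := by
  have h := isDirichletPotential_dirichletPotential hab hk t hv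
  rw [h.integral_conj_mul hab.le h.1, integral_conj_mul_self, integral_conj_mul_self,
    ← Complex.ofReal_add, ← sq_hTildeNorm hab.le, hTildeNegNorm]

end Dirichlet

section DiagonalOperator

variable {ι 𝕜 E : Type*} [RCLike 𝕜] [NormedAddCommGroup E] [InnerProductSpace 𝕜 E]

/-- The diagonal operator `∑ uᵢ eᵢ ↦ ∑ σᵢ uᵢ eᵢ` of a Hilbert basis, as a function of its bounded
symbol `σ`. -/
noncomputable def diagonalOp (e : HilbertBasis ι 𝕜 E) : lp (fun _ : ι => 𝕜) ∞ →L[𝕜] E →L[𝕜] E :=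
  ContinuousLinearMap.compL 𝕜 E (lp (fun _ : ι => 𝕜) 2) E e.repr.symm.toContinuousLinearEquiv ∘L
    (ContinuousLinearMap.compL 𝕜 E (lp (fun _ : ι => 𝕜) 2) (lp (fun _ : ι => 𝕜) 2)).flip
      e.repr.toContinuousLinearEquiv ∘L
    lp.holderL 2 (fun _ => ContinuousLinearMap.mul 𝕜 𝕜) (K := 1)
      fun _ => ContinuousLinearMap.opNorm_mul_le 𝕜 𝕜

theorem inner_diagonalOp (e : HilbertBasis ι 𝕜 E) (σ : lp (fun _ : ι => 𝕜) ∞) (u : E) (i : ι) :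
    inner 𝕜 (e i) (diagonalOp e σ u) = σ i * inner 𝕜 (e i) u := by
  rw [← e.repr_apply_apply, ← e.repr_apply_apply]
  have h : e.repr (diagonalOp e σ u) =
      lp.holder 2 (fun _ => ContinuousLinearMap.mul 𝕜 𝕜)
        (fun _ => ContinuousLinearMap.opNorm_mul_le 𝕜 𝕜) σ (e.repr u) :=
    e.repr.apply_symm_apply _
  rw [h]
  rfl

theorem hasSum_diagonalOp (e : HilbertBasis ι 𝕜 E) (σ : lp (fun _ : ι => 𝕜) ∞) (u : E) :
    HasSum (fun i => (σ i * inner 𝕜 (e i) u) • e i) (diagonalOp e σ u) := by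
  simpa only [e.repr_apply_apply, inner_diagonalOp] using e.hasSum_repr (diagonalOp e σ u)

theorem hasSum_inner_diagonalOp (e : HilbertBasis ι 𝕜 E) (σ : lp (fun _ : ι => 𝕜) ∞) (u : E) :
    HasSum (fun i => σ i * (‖inner 𝕜 (e i) u‖ : 𝕜) ^ 2) (inner 𝕜 u (diagonalOp e σ u)) := by
  refine (e.hasSum_inner_mul_inner u (diagonalOp e σ u)).congr_fun fun i => ?_
  rw [inner_diagonalOp, ← inner_conj_symm u, ← RCLike.conj_mul]
  ring

theorem isSymmetric_diagonalOp (e : HilbertBasis ι 𝕜 E) {σ : lp (fun _ : ι => 𝕜) ∞}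
    (hσ : ∀ i, starRingEnd 𝕜 (σ i) = σ i) : (diagonalOp e σ : E →ₗ[𝕜] E).IsSymmetric := by
  intro u v
  refine (e.hasSum_inner_mul_inner (diagonalOp e σ u) v).unique ?_
  refine (e.hasSum_inner_mul_inner u (diagonalOp e σ v)).congr_fun fun i => ?_
  rw [inner_diagonalOp, ← inner_conj_symm, inner_diagonalOp, map_mul, hσ, inner_conj_symm]
  ring

end DiagonalOperator

section ProductRule

variable {E : Type*} [NormedAddCommGroup E] [InnerProductSpace ℂ E]

theorem re_inner_apply_sub_re_inner_apply {T : E →ₗ[ℂ] E} (hT : T.IsSymmetric) (u v : E) :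
    (inner ℂ u (T u)).re - (inner ℂ v (T v)).re = (inner ℂ (u - v) (T (u + v))).re := by
  have h : (inner ℂ u (T v)).re = (inner ℂ v (T u)).re := by
    rw [← hT u v, ← inner_conj_symm, Complex.conj_re]
  simp only [map_add, inner_sub_left, inner_add_right, Complex.sub_re, Complex.add_re, h]
  ring

/-- Only the quadratic form of `A` at the fixed vector `W t` has to be differentiable: the rest of
the increment is `re ⟪W s - W t, A s (W s + W t)⟫`, where continuity of `A` suffices. -/
theorem hasDerivWithinAt_re_inner_apply {A : ℝ → E →L[ℂ] E} {W : ℝ → E} {V : E} {J : Set ℝ}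
    {t d : ℝ} (hA : ∀ s, (A s : E →ₗ[ℂ] E).IsSymmetric) (hcont : ContinuousWithinAt A J t)
    (hform : HasDerivWithinAt (fun s => (inner ℂ (W t) (A s (W t))).re) d J t)
    (hW : HasDerivWithinAt W V J t) :
    HasDerivWithinAt (fun s => (inner ℂ (W s) (A s (W s))).re)
      (d + 2 * (inner ℂ V (A t (W t))).re) J t := by
  suffices h : HasDerivWithinAt
      (fun s => (inner ℂ (W s) (A s (W s))).re - (inner ℂ (W t) (A s (W t))).re)
      (2 * (inner ℂ V (A t (W t))).re) J t by
    simpa using hform.fun_add h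
  have hlim : Filter.Tendsto (fun s => A s (W s + W t)) (nhdsWithin t (J \ {t}))
      (nhds (A t (W t + W t))) :=
    ((hcont.clm_apply (hW.continuousWithinAt.add continuousWithinAt_const)).mono sdiff_subset)
  rw [hasDerivWithinAt_iff_tendsto_slope] at hW ⊢
  have hslope := (Complex.continuous_re.tendsto _).comp (hW.inner (𝕜 := ℂ) hlim)
  rw [map_add, inner_add_right, Complex.add_re, ← two_mul] at hslope
  refine hslope.congr fun s => ?_
  have hsub := re_inner_apply_sub_re_inner_apply (hA s) (W s) (W t)
  simp only [ContinuousLinearMap.coe_coe] at hsub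
  simp only [Function.comp_apply, slope, vsub_eq_sub, sub_self, sub_zero, hsub,
    inner_smul_left_eq_smul, Complex.real_smul, Complex.re_ofReal_mul, smul_eq_mul]

end ProductRule

section Fourier

variable {a b : ℝ} {φ : ℝ → ℂ}

theorem inner_mode (m : ℤ) (u : L2 a b) :
    inner ℂ (mode a b m) u = ∫ y, star (modeFun a b m y) * u y ∂(intervalMeasure a b) := by
  simpa only [Lp.toLp_coeFn, mode] using inner_toLp (memLp_modeFun a b m) (Lp.memLp u)

theorem inner_mode_eq_fourierCoeffOn (hab : a < b) (m : ℤ) (u : L2 a b) :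
    inner ℂ (mode a b m) u = (Real.sqrt (b - a) : ℂ) * fourierCoeffOn hab u m := by
  have hs : (Real.sqrt (b - a) : ℂ) ≠ 0 := by
    exact_mod_cast (Real.sqrt_pos.2 (sub_pos.2 hab)).ne'
  have hone : (Real.sqrt (b - a) : ℂ) * (1 / (b - a) : ℝ) * Real.sqrt (b - a) = 1 := by
    rw [mul_right_comm, ← Complex.ofReal_mul, Real.mul_self_sqrt (sub_pos.2 hab).le,
      ← Complex.ofReal_mul, mul_one_div_cancel (sub_pos.2 hab).ne', Complex.ofReal_one]
  have hstar : ∀ y, star (modeFun a b m y) =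
      (Real.sqrt (b - a) : ℂ) * (1 / (b - a) : ℝ) * fourier (-m) (y : AddCircle (b - a)) := by
    intro y
    simp only [fourier_coe_apply, modeFun, freq, Complex.star_def, map_div₀, Complex.conj_ofReal,
      ← Complex.exp_conj, map_mul, Complex.conj_I]
    rw [show -Complex.I * ((2 * Real.pi * m / (b - a) * y : ℝ) : ℂ) =
      2 * Real.pi * Complex.I * ((-m : ℤ) : ℂ) * y / ((b - a : ℝ) : ℂ) by push_cast; ring,
      div_eq_iff hs]
    linear_combination -Complex.exp (2 * Real.pi * Complex.I * ((-m : ℤ) : ℂ) * y /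
      ((b - a : ℝ) : ℂ)) * hone
  rw [inner_mode, fourierCoeffOn_eq_integral, intervalIntegral.integral_of_le hab.le,
    Complex.real_smul, ← mul_assoc, ← integral_const_mul]
  simp only [hstar, smul_eq_mul, mul_assoc]

theorem hasSum_sq_norm_inner_mode (hab : a < b) (u : L2 a b) :
    HasSum (fun m => ‖inner ℂ (mode a b m) u‖ ^ 2) (‖u‖ ^ 2) := by
  have hnorm : ‖u‖ ^ 2 = ∫ y, ‖u y‖ ^ 2 ∂(intervalMeasure a b) := by
    simpa only [Lp.toLp_coeFn] using norm_toLp_sq (Lp.memLp u)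
  have h := (hasSum_sq_fourierCoeffOn hab (Lp.memLp u)).mul_left (b - a)
  rw [intervalIntegral.integral_of_le hab.le, ← hnorm, smul_eq_mul,
    mul_inv_cancel_left₀ (sub_pos.2 hab).ne'] at h
  refine h.congr_fun fun m => ?_
  rw [inner_mode_eq_fourierCoeffOn hab, norm_mul, Complex.norm_real, mul_pow, Real.norm_eq_abs,
    sq_abs, Real.sq_sqrt (sub_pos.2 hab).le]

theorem norm_modeFun (m : ℤ) (y : ℝ) : ‖modeFun a b m y‖ = (Real.sqrt (b - a))⁻¹ := by
  rw [modeFun, norm_div, mul_comm Complex.I, Complex.norm_exp_ofReal_mul_I, Complex.norm_real,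
    Real.norm_of_nonneg (Real.sqrt_nonneg _), one_div]

theorem norm_mode (hab : a < b) (m : ℤ) : ‖mode a b m‖ = 1 := by
  have h : ‖mode a b m‖ ^ 2 = 1 := by
    rw [mode, norm_toLp_sq]
    simp [norm_modeFun, hab.le, (sub_pos.2 hab).ne']
  exact (pow_eq_one_iff_of_nonneg (norm_nonneg _) two_ne_zero).1 h

/-- The modes have norm one, so each of them exhausts its own Parseval sum. -/
theorem orthonormal_mode (hab : a < b) : Orthonormal ℂ (mode a b) := by
  refine ⟨norm_mode hab, fun n m hnm => ?_⟩
  have h := sum_le_hasSum {n, m} (fun i _ => by positivity)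
    (hasSum_sq_norm_inner_mode hab (mode a b m))
  rw [Finset.sum_pair hnm, inner_self_eq_norm_sq_to_K, norm_mode hab] at h
  have h0 : ‖(inner ℂ (mode a b n) (mode a b m) : ℂ)‖ ^ 2 ≤ 0 := by simpa using h
  exact norm_eq_zero.1 (pow_eq_zero_iff two_ne_zero |>.1 (le_antisymm h0 (by positivity)))

theorem eq_zero_of_inner_mode_eq_zero (hab : a < b) {u : L2 a b}
    (h : ∀ m, inner ℂ (mode a b m) u = 0) : u = 0 := by
  have hsum := hasSum_sq_norm_inner_mode hab u
  simp only [h, norm_zero, ne_eq, OfNat.ofNat_ne_zero, not_false_eq_true, zero_pow] at hsum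
  exact norm_eq_zero.1 (pow_eq_zero_iff two_ne_zero |>.1 (hsum.unique hasSum_zero))

/-- The Fourier modes as a Hilbert basis of `L²([a, b])`, which makes `weightOp` one of its diagonal
operators. -/
noncomputable def modeBasis (hab : a < b) : HilbertBasis ℤ ℂ (L2 a b) :=
  HilbertBasis.mkOfOrthogonalEqBot (orthonormal_mode hab) <| by
    rw [Submodule.eq_bot_iff]
    exact fun u hu => eq_zero_of_inner_mode_eq_zero hab fun m =>
      (Submodule.mem_orthogonal _ _).1 hu _ (Submodule.subset_span ⟨m, rfl⟩)

@[simp]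
theorem coe_modeBasis (hab : a < b) : ⇑(modeBasis hab) = mode a b :=
  HilbertBasis.coe_mkOfOrthogonalEqBot ..

theorem deriv_modeFun (m : ℤ) (y : ℝ) :
    deriv (modeFun a b m) y = Complex.I * (freq a b m : ℂ) * modeFun a b m y := by
  have h : HasDerivAt (fun y : ℝ => Complex.I * ((freq a b m * y : ℝ) : ℂ))
      (Complex.I * ((freq a b m * 1 : ℝ) : ℂ)) y :=
    (((hasDerivAt_id y).const_mul (freq a b m)).ofReal_comp).const_mul Complex.I
  refine (h.cexp.div_const ((Real.sqrt (b - a) : ℝ) : ℂ)).deriv.trans ?_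
  rw [modeFun, mul_one]
  ring

/-- The shifted frequency `n / k - t`: the modes are eigenfunctions of `∂_y / k - i t`, with
eigenvalues `i (n / k - t)`. -/
noncomputable def shiftedFreq (a b k t : ℝ) (m : ℤ) : ℝ := freq a b m / k - t

theorem shiftedDeriv_modeFun (k t : ℝ) (m : ℤ) (y : ℝ) :
    shiftedDeriv k t (modeFun a b m) y =
      Complex.I * (shiftedFreq a b k t m : ℂ) * modeFun a b m y := by
  rw [shiftedDeriv, deriv_modeFun, shiftedFreq]
  push_cast
  ring

theorem isH1_modeFun (hab : a ≤ b) (m : ℤ) : IsH1 a b (modeFun a b m) := by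
  have hexp : modeFun a b m = fun y : ℝ =>
      Complex.exp (Complex.I * (freq a b m * a : ℝ)) / (Real.sqrt (b - a) : ℂ) *
        Complex.exp (Complex.I * freq a b m * (y - a)) := by
    funext y
    rw [modeFun, div_mul_eq_mul_div, ← Complex.exp_add]
    push_cast
    ring_nf
  rw [hexp]
  exact (isH1_cexp_mul_sub hab _).const_mul _

theorem inner_mode_shiftedDeriv (hab : a ≤ b) (hφ : IsH10 a b φ) (k t : ℝ) (m : ℤ) :
    inner ℂ (mode a b m) ((hφ.1.memLp_shiftedDeriv hab k t).toLp (shiftedDeriv k t φ)) =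
      Complex.I * (shiftedFreq a b k t m : ℂ) *
        inner ℂ (mode a b m) ((hφ.1.memLp hab).toLp φ) := by
  have hconj : ∀ y, star (φ y) * shiftedDeriv k t (modeFun a b m) y =
      Complex.I * (shiftedFreq a b k t m : ℂ) * (star (φ y) * modeFun a b m y) := fun y => by
    rw [shiftedDeriv_modeFun]
    ring
  have hparts := integral_conj_mul_shiftedDeriv hab hφ (isH1_modeFun hab m) k t
  simp only [hconj, integral_const_mul] at hparts
  rw [← inner_conj_symm, ← inner_conj_symm (mode a b m), mode, inner_toLp, inner_toLp,
    ← neg_eq_iff_eq_neg.2 hparts, map_neg, map_mul, map_mul, Complex.conj_I, Complex.conj_ofReal]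
  ring

theorem hasSum_sq_hTildeNorm (hab : a < b) (hφ : IsH10 a b φ) (k t : ℝ) :
    HasSum (fun m => (1 + shiftedFreq a b k t m ^ 2) *
      ‖inner ℂ (mode a b m) ((hφ.1.memLp hab.le).toLp φ)‖ ^ 2) (hTildeNorm a b k t φ ^ 2) := by
  rw [hφ.1.sq_hTildeNorm_eq_norm_toLp hab.le]
  refine ((hasSum_sq_norm_inner_mode hab _).add (hasSum_sq_norm_inner_mode hab _)).congr_fun
    fun m => ?_
  rw [inner_mode_shiftedDeriv hab.le hφ, norm_mul, norm_mul, Complex.norm_I, Complex.norm_real,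
    one_mul, mul_pow, Real.norm_eq_abs, sq_abs]
  ring

end Fourier

section Weight

variable {a b : ℝ}

/-- The symbol `exp (arctan (n / k - t))` of `A(t)`. -/
noncomputable def weight (a b k t : ℝ) (m : ℤ) : ℝ :=
  Real.exp (Real.arctan (shiftedFreq a b k t m))

theorem weight_pos (k t : ℝ) (m : ℤ) : 0 < weight a b k t m := Real.exp_pos _

theorem weight_le (k t : ℝ) (m : ℤ) : weight a b k t m ≤ Real.exp (Real.pi / 2) :=
  Real.exp_le_exp.2 (Real.arctan_lt_pi_div_two _).le

theorem le_weight (k t : ℝ) (m : ℤ) : Real.exp (-(Real.pi / 2)) ≤ weight a b k t m :=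
  Real.exp_le_exp.2 (Real.neg_pi_div_two_lt_arctan _).le

theorem one_le_exp_mul_weight (k t : ℝ) (m : ℤ) :
    1 ≤ Real.exp (Real.pi / 2) * weight a b k t m := by
  rw [← div_le_iff₀' (Real.exp_pos _), one_div, ← Real.exp_neg]
  exact le_weight k t m

theorem hasDerivAt_weight (k t : ℝ) (m : ℤ) :
    HasDerivAt (fun s => weight a b k s m)
      (-(weight a b k t m / (1 + shiftedFreq a b k t m ^ 2))) t := by
  have h : HasDerivAt (fun s => shiftedFreq a b k s m) (-1) t :=
    (hasDerivAt_id t).const_sub (freq a b m / k)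
  refine h.arctan.exp.congr_deriv ?_
  simp only [weight]
  ring

theorem abs_weight_div_le (k t : ℝ) (m : ℤ) :
    |weight a b k t m / (1 + shiftedFreq a b k t m ^ 2)| ≤ Real.exp (Real.pi / 2) := by
  rw [abs_of_nonneg (div_nonneg (weight_pos k t m).le (by positivity))]
  exact (div_le_self (weight_pos k t m).le (le_add_of_nonneg_right (sq_nonneg _))).trans
    (weight_le k t m)

theorem abs_weight_sub_le (k s t : ℝ) (m : ℤ) :
    |weight a b k s m - weight a b k t m| ≤ Real.exp (Real.pi / 2) * |s - t| := by
  refine Convex.norm_image_sub_le_of_norm_hasDerivWithin_le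
    (fun x _ => (hasDerivAt_weight (a := a) (b := b) k x m).hasDerivWithinAt) (fun x _ => ?_)
    convex_univ (mem_univ t) (mem_univ s)
  rw [norm_neg]
  exact abs_weight_div_le k x m

/-- The symbol of `A(t)` as an element of `ℓ^∞`, so that `A(t)` is the diagonal operator with this
symbol in the Fourier basis. -/
noncomputable def weightSymbol (a b k t : ℝ) : lp (fun _ : ℤ => ℂ) ∞ :=
  ⟨fun m => weight a b k t m, memℓp_infty ⟨Real.exp (Real.pi / 2), by
    rintro _ ⟨m, rfl⟩
    simpa only [Complex.norm_real, Real.norm_of_nonneg (weight_pos k t m).le]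
      using weight_le k t m⟩⟩

theorem weightSymbol_apply (k t : ℝ) (m : ℤ) : weightSymbol a b k t m = weight a b k t m := rfl

theorem continuous_weightSymbol (k : ℝ) : Continuous (weightSymbol a b k) := by
  refine (LipschitzWith.of_dist_le_mul (K := (Real.exp (Real.pi / 2)).toNNReal)
    fun s t => ?_).continuous
  rw [dist_eq_norm, Real.dist_eq, Real.coe_toNNReal _ (Real.exp_pos _).le]
  refine lp.norm_le_of_forall_le (by positivity) fun m => ?_
  rw [lp.coeFn_sub, Pi.sub_apply, weightSymbol_apply, weightSymbol_apply, ← Complex.ofReal_sub,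
    Complex.norm_real]
  exact abs_weight_sub_le k s t m

theorem weightOp_eq_diagonalOp (hab : a < b) (k t : ℝ) (u : L2 a b) :
    weightOp a b k t u = diagonalOp (modeBasis hab) (weightSymbol a b k t) u := by
  have h := hasSum_diagonalOp (modeBasis hab) (weightSymbol a b k t) u
  simp only [coe_modeBasis, weightSymbol_apply, weight, shiftedFreq] at h
  exact h.tsum_eq

theorem inner_mode_weightOp (hab : a < b) (k t : ℝ) (u : L2 a b) (m : ℤ) :
    inner ℂ (mode a b m) (weightOp a b k t u) =
      (weight a b k t m : ℂ) * inner ℂ (mode a b m) u := by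
  rw [weightOp_eq_diagonalOp hab, ← coe_modeBasis hab, inner_diagonalOp, weightSymbol_apply]

theorem hasSum_weightForm (hab : a < b) (k t : ℝ) (u : L2 a b) :
    HasSum (fun m => weight a b k t m * ‖inner ℂ (mode a b m) u‖ ^ 2) (weightForm a b k t u) := by
  have h := Complex.hasSum_re (hasSum_inner_diagonalOp (modeBasis hab) (weightSymbol a b k t) u)
  rw [← weightOp_eq_diagonalOp hab, coe_modeBasis] at h
  refine h.congr_fun fun m => ?_
  rw [weightSymbol_apply, Complex.re_ofReal_mul]
  norm_cast

theorem weightForm_le (hab : a < b) (k t : ℝ) (u : L2 a b) :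
    weightForm a b k t u ≤ Real.exp (Real.pi / 2) * ‖u‖ ^ 2 :=
  hasSum_le (fun m => mul_le_mul_of_nonneg_right (weight_le k t m) (by positivity))
    (hasSum_weightForm hab k t u) ((hasSum_sq_norm_inner_mode hab u).mul_left _)

theorem le_weightForm (hab : a < b) (k t : ℝ) (u : L2 a b) :
    Real.exp (-(Real.pi / 2)) * ‖u‖ ^ 2 ≤ weightForm a b k t u :=
  hasSum_le (fun m => mul_le_mul_of_nonneg_right (le_weight k t m) (by positivity))
    ((hasSum_sq_norm_inner_mode hab u).mul_left _) (hasSum_weightForm hab k t u)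

/-- The dissipation `-⟨u, Ȧ(t) u⟩` produced by the decay of the symbol of `A(t)`. -/
noncomputable def dissipation (a b k t : ℝ) (u : L2 a b) : ℝ :=
  ∑' m, weight a b k t m / (1 + shiftedFreq a b k t m ^ 2) * ‖inner ℂ (mode a b m) u‖ ^ 2

theorem hasSum_dissipation (hab : a < b) (k t : ℝ) (u : L2 a b) :
    HasSum (fun m => weight a b k t m / (1 + shiftedFreq a b k t m ^ 2) *
      ‖inner ℂ (mode a b m) u‖ ^ 2) (dissipation a b k t u) := by
  refine (Summable.of_norm_bounded
    ((hasSum_sq_norm_inner_mode hab u).summable.mul_left (Real.exp (Real.pi / 2)))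
    fun m => ?_).hasSum
  rw [norm_mul, norm_pow, norm_norm]
  gcongr
  exact abs_weight_div_le k t m

theorem hasDerivAt_weightForm (hab : a < b) (k t : ℝ) (u : L2 a b) :
    HasDerivAt (fun s => weightForm a b k s u) (-dissipation a b k t u) t := by
  have hform : (fun s => weightForm a b k s u) = fun s =>
      ∑' m, weight a b k s m * ‖inner ℂ (mode a b m) u‖ ^ 2 :=
    funext fun s => (hasSum_weightForm hab k s u).tsum_eq.symm
  rw [hform, dissipation, ← tsum_neg]
  simp only [← neg_mul]
  refine hasDerivAt_tsum (y₀ := t)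
    ((hasSum_sq_norm_inner_mode hab u).summable.mul_left (Real.exp (Real.pi / 2)))
    (fun m s => (hasDerivAt_weight k s m).mul_const _) (fun m s => ?_)
    (hasSum_weightForm hab k t u).summable t
  rw [norm_mul, norm_neg, norm_pow, norm_norm]
  gcongr
  exact abs_weight_div_le k s m

theorem hasDerivWithinAt_weightForm (hab : a < b) (k : ℝ) {t : ℝ} {J : Set ℝ} {W : ℝ → L2 a b}
    {V : L2 a b} (hW : HasDerivWithinAt W V J t) :
    HasDerivWithinAt (fun s => weightForm a b k s (W s))
      (-dissipation a b k t (W t) + 2 * (inner ℂ V (weightOp a b k t (W t))).re) J t := by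
  have hform := (hasDerivAt_weightForm hab k t (W t)).hasDerivWithinAt (s := J)
  simp only [weightForm, weightOp_eq_diagonalOp hab] at hform ⊢
  exact hasDerivWithinAt_re_inner_apply
    (fun s => isSymmetric_diagonalOp _ fun m => Complex.conj_ofReal _)
    ((diagonalOp (modeBasis hab)).continuous.comp
      (continuous_weightSymbol k)).continuousWithinAt hform hW

end Weight

section WeightConstant

variable {a b k : ℝ}

/-- Parseval and `2 x y ≤ q x² + y² / q` in the duality `‖v‖²₋₁ = -⟨Ψ[v], v⟩`; half of the right
side is absorbed because `‖Ψ[v]‖₁ = ‖v‖₋₁`. -/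
theorem sq_hTildeNegNorm_le_of_hasSum (hab : a < b) (hk : k ≠ 0) (t : ℝ) (v : L2 a b)
    {c : ℤ → ℝ} {S : ℝ} (hc : HasSum c S)
    (h : ∀ m, ‖inner ℂ (mode a b m) v‖ ^ 2 ≤ (1 + shiftedFreq a b k t m ^ 2) * c m) :
    hTildeNegNorm a b k t v ^ 2 ≤ S := by
  have hψ := (isDirichletPotential_dirichletPotential hab hk t (Lp.memLp v)).1
  have hdual : ‖inner ℂ ((hψ.1.memLp hab.le).toLp _) v‖ = hTildeNegNorm a b k t v ^ 2 := by
    have hinner := inner_toLp (hψ.1.memLp hab.le) (Lp.memLp v)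
    rw [Lp.toLp_coeFn] at hinner
    rw [hinner, integral_conj_dirichletPotential_mul hab hk t (Lp.memLp v), norm_neg,
      Complex.norm_real, Real.norm_of_nonneg (sq_nonneg _)]
  have hparseval := (modeBasis hab).hasSum_inner_mul_inner ((hψ.1.memLp hab.le).toLp _) v
  rw [coe_modeBasis] at hparseval
  have hle := hparseval.norm_le_of_bounded
    (((hasSum_sq_hTildeNorm hab hψ k t).add hc).div_const 2) fun m => by
      have hc0 : 0 ≤ c m := nonneg_of_mul_nonneg_right ((sq_nonneg _).trans (h m)) (by positivity)
      rw [norm_mul, norm_inner_symm]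
      refine le_of_sq_le_sq ?_ (by positivity)
      rw [mul_pow]
      generalize ‖inner ℂ (mode a b m) ((hψ.1.memLp hab.le).toLp _)‖ = x at *
      nlinarith [mul_le_mul_of_nonneg_left (h m) (sq_nonneg x),
        sq_nonneg ((1 + shiftedFreq a b k t m ^ 2) * x ^ 2 - c m)]
  rw [hdual] at hle
  change _ ≤ (hTildeNegNorm a b k t v ^ 2 + S) / 2 at hle
  linarith

theorem sq_hTildeNegNorm_le_dissipation (hab : a < b) (hk : k ≠ 0) (t : ℝ) (u : L2 a b) :
    hTildeNegNorm a b k t u ^ 2 ≤ Real.exp (Real.pi / 2) * dissipation a b k t u := by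
  refine sq_hTildeNegNorm_le_of_hasSum hab hk t u
    ((hasSum_dissipation hab k t u).mul_left _) fun m => ?_
  calc ‖inner ℂ (mode a b m) u‖ ^ 2
      ≤ Real.exp (Real.pi / 2) * weight a b k t m * ‖inner ℂ (mode a b m) u‖ ^ 2 :=
        le_mul_of_one_le_left (sq_nonneg _) (one_le_exp_mul_weight k t m)
    _ = _ := by field_simp

theorem sq_hTildeNegNorm_weightOp_le_dissipation (hab : a < b) (hk : k ≠ 0) (t : ℝ)
    (u : L2 a b) :
    hTildeNegNorm a b k t (weightOp a b k t u) ^ 2 ≤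
      Real.exp (Real.pi / 2) * dissipation a b k t u := by
  refine sq_hTildeNegNorm_le_of_hasSum hab hk t _
    ((hasSum_dissipation hab k t u).mul_left _) fun m => ?_
  rw [inner_mode_weightOp hab, norm_mul, mul_pow, Complex.norm_real,
    Real.norm_of_nonneg (weight_pos k t m).le]
  calc weight a b k t m ^ 2 * ‖inner ℂ (mode a b m) u‖ ^ 2
      = weight a b k t m * (weight a b k t m * ‖inner ℂ (mode a b m) u‖ ^ 2) := by ring
    _ ≤ Real.exp (Real.pi / 2) * (weight a b k t m * ‖inner ℂ (mode a b m) u‖ ^ 2) :=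
        mul_le_mul_of_nonneg_right (weight_le k t m)
          (mul_nonneg (weight_pos k t m).le (sq_nonneg _))
    _ = _ := by field_simp

theorem isWeightConstant_exp_pi_div_two (hab : a < b) (hk : k ≠ 0) :
    IsWeightConstant a b k (Real.exp (Real.pi / 2)) := by
  intro t u
  rw [(hasDerivAt_weightForm hab k t u).deriv, neg_mul_neg]
  linarith [two_mul_le_add_sq (hTildeNegNorm a b k t u)
      (hTildeNegNorm a b k t (weightOp a b k t u)),
    sq_hTildeNegNorm_le_dissipation hab hk t u,
    sq_hTildeNegNorm_weightOp_le_dissipation hab hk t u]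

end WeightConstant

section Elliptic

/-- The coefficients of the stream function equation: `r' = 1 / g`, the product `r g` has the
constant sign `ε` and `c ≤ |r g| ≤ 1 / c`, and the multiplier `r / g` of the energy argument lies in
`W^{1,∞}`, with bounds `R₀` for itself and `R₁` for its derivative. -/
structure IsStreamCoefficient (a b : ℝ) (g r : ℝ → ℝ) (ε c R₀ R₁ : ℝ) : Prop where
  isH1_radius : IsH1 a b fun y => (r y : ℂ)
  deriv_radius : ∀ᵐ y ∂(intervalMeasure a b), deriv (fun y => (r y : ℂ)) y = (((g y)⁻¹ : ℝ) : ℂ)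
  abs_sign : |ε| = 1
  pos : 0 < c
  le_mul : ∀ᵐ y ∂(intervalMeasure a b), c ≤ ε * (r y * g y)
  mul_le : ∀ᵐ y ∂(intervalMeasure a b), ε * (r y * g y) ≤ c⁻¹
  isH1_div : IsH1 a b fun y => ((r y / g y : ℝ) : ℂ)
  zero_le_bound : 0 ≤ R₀
  zero_le_derivBound : 0 ≤ R₁
  norm_div_le : ∀ᵐ y ∂(intervalMeasure a b), ‖((r y / g y : ℝ) : ℂ)‖ ≤ R₀
  norm_deriv_div_le : ∀ᵐ y ∂(intervalMeasure a b),
    ‖deriv (fun y => ((r y / g y : ℝ) : ℂ)) y‖ ≤ R₁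

/-- The energy density of the stream function equation tested with `(r / g) Φ`. -/
noncomputable def streamEnergy (g r : ℝ → ℝ) (k t : ℝ) (Φ : ℝ → ℂ) (y : ℝ) : ℝ :=
  r y * g y * ‖shiftedDeriv k t Φ y‖ ^ 2 + (r y * g y)⁻¹ * ‖Φ y‖ ^ 2

/-- The multiplier `r / g` turns the principal part into `conj (r Φ) D (g D Φ)`, and since
`(r Φ)' = r Φ' + Φ / g`, the first order term cancels after an integration by parts. -/
theorem conj_mul_streamOperator_sub {k r g : ℝ} (hr : r ≠ 0) (hg : g ≠ 0) (Φ D q : ℂ) :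
    star (((r / g : ℝ) : ℂ) * Φ) * (g * q + g / (k * r) * D - 1 / (r : ℂ) ^ 2 * Φ) -
        star (r * Φ) * q - star (r * D + ((g⁻¹ : ℝ) : ℂ) / k * Φ) * (g * D) =
      ((-(r * g * ‖D‖ ^ 2 + (r * g)⁻¹ * ‖Φ‖ ^ 2) : ℝ) : ℂ) := by
  have hr' : (r : ℂ) ≠ 0 := by exact_mod_cast hr
  have hg' : (g : ℂ) ≠ 0 := by exact_mod_cast hg
  simp only [star_add, star_mul', star_div₀, Complex.star_def, Complex.conj_ofReal]
  push_cast
  rw [← Complex.conj_mul', ← Complex.conj_mul']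
  field_simp
  ring

variable {a b k t ε c R₀ R₁ : ℝ} {g r : ℝ → ℝ} {w Φ : ℝ → ℂ}

theorem IsStreamCoefficient.mul_ne_zero (hgr : IsStreamCoefficient a b g r ε c R₀ R₁) :
    ∀ᵐ y ∂(intervalMeasure a b), r y * g y ≠ 0 := by
  filter_upwards [hgr.le_mul] with y hy h0
  rw [h0, mul_zero] at hy
  exact hy.not_gt hgr.pos

theorem IsStreamCoefficient.integral_streamEnergy (hab : a ≤ b)
    (hgr : IsStreamCoefficient a b g r ε c R₀ R₁) (hw : MemLp w 2 (intervalMeasure a b))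
    (hΦ : IsStreamFunction a b g r k t w Φ) :
    Integrable (streamEnergy g r k t Φ) (intervalMeasure a b) ∧
      ∫ y, star (((r y / g y : ℝ) : ℂ) * Φ y) * w y ∂(intervalMeasure a b) =
        -((∫ y, streamEnergy g r k t Φ y ∂(intervalMeasure a b) : ℝ) : ℂ) := by
  obtain ⟨hΦ₀, p, hp, hpΦ, hwΦ⟩ := hΦ
  have hrΦ := hΦ₀.mul_left hab hgr.isH1_radius
  have hρΦ := hΦ₀.mul_left hab hgr.isH1_div
  have hint_w := integrable_conj_mul (hρΦ.1.memLp hab) hw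
  have hint_Dp := integrable_conj_mul (hrΦ.1.memLp hab) (hp.memLp_shiftedDeriv hab k t)
  have hint_p := integrable_conj_mul (hrΦ.1.memLp_shiftedDeriv hab k t) (hp.memLp hab)
  have hdensity : ∀ᵐ y ∂(intervalMeasure a b),
      star (((r y / g y : ℝ) : ℂ) * Φ y) * w y - star ((r y : ℂ) * Φ y) * shiftedDeriv k t p y -
        star (shiftedDeriv k t (fun y => (r y : ℂ) * Φ y) y) * p y =
      ((-streamEnergy g r k t Φ y : ℝ) : ℂ) := by
    filter_upwards [hpΦ, hwΦ, hgr.mul_ne_zero, hgr.deriv_radius,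
      shiftedDeriv_mul hab hgr.isH1_radius hΦ₀.1 k t] with y hp hw hrg hr hmul
    rw [← hw, hmul, hr, hp]
    exact conj_mul_streamOperator_sub (left_ne_zero_of_mul hrg) (right_ne_zero_of_mul hrg) ..
  constructor
  · refine ((hint_w.sub hint_Dp).sub hint_p).neg.re.congr ?_
    filter_upwards [hdensity] with y hy
    simp only [Pi.neg_apply, Pi.sub_apply]
    rw [hy, ← Complex.ofReal_neg, neg_neg]
    exact Complex.ofReal_re _
  · have hsub := integral_sub (hint_w.sub hint_Dp) hint_p
    simp only [Pi.sub_apply] at hsub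
    rw [← Complex.ofReal_neg, ← integral_neg, ← integral_complex_ofReal,
      ← integral_congr_ae hdensity, hsub, integral_sub hint_w hint_Dp,
      integral_conj_mul_shiftedDeriv hab hrΦ hp]
    ring

theorem IsStreamCoefficient.le_inv_mul (hgr : IsStreamCoefficient a b g r ε c R₀ R₁) :
    ∀ᵐ y ∂(intervalMeasure a b), c ≤ ε * (r y * g y)⁻¹ := by
  have hε : ε⁻¹ = ε :=
    inv_eq_of_mul_eq_one_right (by rw [← abs_mul_abs_self, hgr.abs_sign, one_mul])
  filter_upwards [hgr.le_mul, hgr.mul_le] with y hle hge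
  rw [← hε, ← mul_inv]
  exact le_inv_of_le_inv₀ (hgr.pos.trans_le hle) hge

theorem IsStreamCoefficient.mul_sq_hTildeNorm_le (hab : a ≤ b)
    (hgr : IsStreamCoefficient a b g r ε c R₀ R₁) (hΦ : IsH1 a b Φ)
    (hint : Integrable (streamEnergy g r k t Φ) (intervalMeasure a b)) :
    c * hTildeNorm a b k t Φ ^ 2 ≤ |∫ y, streamEnergy g r k t Φ y ∂(intervalMeasure a b)| := by
  have hintΦ := (hΦ.memLp hab).integrable_norm_pow two_ne_zero
  have hintD := (hΦ.memLp_shiftedDeriv hab k t).integrable_norm_pow two_ne_zero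
  calc c * hTildeNorm a b k t Φ ^ 2
      = ∫ y, c * (‖Φ y‖ ^ 2 + ‖shiftedDeriv k t Φ y‖ ^ 2) ∂(intervalMeasure a b) := by
        rw [integral_const_mul, integral_add hintΦ hintD, sq_hTildeNorm hab]
    _ ≤ ∫ y, ε * streamEnergy g r k t Φ y ∂(intervalMeasure a b) := by
        refine integral_mono_ae ((hintΦ.add hintD).const_mul c) (hint.const_mul ε) ?_
        filter_upwards [hgr.le_mul, hgr.le_inv_mul] with y hD hΦ
        have := mul_le_mul_of_nonneg_right hD (sq_nonneg ‖shiftedDeriv k t Φ y‖)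
        have := mul_le_mul_of_nonneg_right hΦ (sq_nonneg ‖Φ y‖)
        rw [streamEnergy]
        linarith
    _ ≤ |ε * ∫ y, streamEnergy g r k t Φ y ∂(intervalMeasure a b)| := by
        rw [integral_const_mul]
        exact le_abs_self _
    _ = _ := by rw [abs_mul, hgr.abs_sign, one_mul]

theorem IsStreamCoefficient.isEllipticConstant (hab : a < b)
    (hgr : IsStreamCoefficient a b g r ε c R₀ R₁) (hk : k ≠ 0) :
    IsEllipticConstant a b g r k ((R₀ + |k|⁻¹ * R₁) / c) := by
  intro t w Φ hΦ
  obtain ⟨hint, henergy⟩ := hgr.integral_streamEnergy hab.le (Lp.memLp w) hΦ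
  have hdual := norm_integral_conj_mul_le hab hk t (Lp.memLp w) (hΦ.1.mul_left hab.le hgr.isH1_div)
  rw [henergy, norm_neg, Complex.norm_real, Real.norm_eq_abs] at hdual
  have hmul := hTildeNorm_mul_le hab.le hgr.isH1_div hΦ.1.1 k t hgr.zero_le_bound
    hgr.zero_le_derivBound hgr.norm_div_le hgr.norm_deriv_div_le
  have hquad : c * hTildeNorm a b k t Φ ^ 2 ≤
      (R₀ + |k|⁻¹ * R₁) * hTildeNorm a b k t Φ * hTildeNegNorm a b k t w :=
    ((hgr.mul_sq_hTildeNorm_le hab.le hΦ.1.1 hint).trans hdual).trans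
      (mul_le_mul_of_nonneg_right hmul (hTildeNegNorm_nonneg ..))
  have := hgr.pos
  have := hgr.zero_le_bound
  have := hgr.zero_le_derivBound
  have := hTildeNegNorm_nonneg a b k t w
  rcases (hTildeNorm_nonneg a b k t Φ).eq_or_lt with hzero | hpos
  · rw [← hzero]
    positivity
  · rw [div_mul_eq_mul_div, le_div_iff₀ hgr.pos]
    refine le_of_mul_le_mul_right ?_ hpos
    linarith

end Elliptic

section AngularVelocity

namespace IsAngularVelocity

variable {r₁ r₂ : ℝ} {U : ℝ → ℝ}

theorem leftEnd_lt_rightEnd (hU : IsAngularVelocity r₁ r₂ U) :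
    leftEnd r₁ r₂ U < rightEnd r₁ r₂ U := by
  have hl := left_mem_Icc.2 hU.lt.le
  have hr := right_mem_Icc.2 hU.lt.le
  refine min_lt_max.2 ?_
  rcases hU.strictMono_or_strictAnti with h | h
  · exact (h hl hr hU.lt).ne
  · exact (h hl hr hU.lt).ne'

theorem hasDerivAt (hU : IsAngularVelocity r₁ r₂ U) {x : ℝ} (hx : x ∈ Ioo r₁ r₂) :
    HasDerivAt U (derivWithin U (Icc r₁ r₂) x) x :=
  (hU.differentiableOn x (Ioo_subset_Icc_self hx)).hasDerivWithinAt.hasDerivAt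
    (Icc_mem_nhds hx.1 hx.2)

theorem exists_sign (hU : IsAngularVelocity r₁ r₂ U) :
    ∃ ε : ℝ, |ε| = 1 ∧ ∀ x ∈ Icc r₁ r₂, 0 < ε * derivWithin U (Icc r₁ r₂) x := by
  rcases hU.strictMono_or_strictAnti with h | h
  · refine ⟨1, abs_one, fun x hx => ?_⟩
    rw [one_mul]
    exact h.monotoneOn.derivWithin_nonneg.lt_of_ne' (hU.deriv_ne_zero x hx)
  · refine ⟨-1, by rw [abs_neg, abs_one], fun x hx => ?_⟩
    rw [neg_one_mul, neg_pos]
    exact h.antitoneOn.derivWithin_nonpos.lt_of_ne (hU.deriv_ne_zero x hx)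

theorem exists_deriv_bounds (hU : IsAngularVelocity r₁ r₂ U) :
    ∃ ε m M : ℝ, |ε| = 1 ∧ 0 < m ∧ 0 < M ∧
      ∀ x ∈ Icc r₁ r₂, ε * derivWithin U (Icc r₁ r₂) x ∈ Icc m M := by
  obtain ⟨K, hK⟩ := hU.lipschitz_deriv
  obtain ⟨ε, hε, hpos⟩ := hU.exists_sign
  have hcont := hK.continuousOn.const_mul ε
  have hne : (Icc r₁ r₂).Nonempty := nonempty_Icc.2 hU.lt.le
  obtain ⟨x, hx, hmin⟩ := isCompact_Icc.exists_isMinOn hne hcont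
  obtain ⟨z, hz, hmax⟩ := isCompact_Icc.exists_isMaxOn hne hcont
  exact ⟨ε, _, _, hε, hpos x hx, hpos z hz, fun y hy => ⟨hmin hy, hmax hy⟩⟩

theorem surjOn (hU : IsAngularVelocity r₁ r₂ U) :
    SurjOn U (Icc r₁ r₂) (Icc (leftEnd r₁ r₂ U) (rightEnd r₁ r₂ U)) :=
  hU.differentiableOn.continuousOn.surjOn_uIcc (left_mem_Icc.2 hU.lt.le) (right_mem_Icc.2 hU.lt.le)

theorem radius_mem (hU : IsAngularVelocity r₁ r₂ U) {y : ℝ}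
    (hy : y ∈ Icc (leftEnd r₁ r₂ U) (rightEnd r₁ r₂ U)) : radius r₁ r₂ U y ∈ Icc r₁ r₂ :=
  Function.invFunOn_mem (hU.surjOn hy)

theorem apply_radius (hU : IsAngularVelocity r₁ r₂ U) {y : ℝ}
    (hy : y ∈ Icc (leftEnd r₁ r₂ U) (rightEnd r₁ r₂ U)) : U (radius r₁ r₂ U y) = y :=
  Function.invFunOn_eq (hU.surjOn hy)

theorem radius_mem_Ioo (hU : IsAngularVelocity r₁ r₂ U) {y : ℝ}
    (hy : y ∈ Ioo (leftEnd r₁ r₂ U) (rightEnd r₁ r₂ U)) : radius r₁ r₂ U y ∈ Ioo r₁ r₂ := by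
  have hmem := hU.radius_mem (Ioo_subset_Icc_self hy)
  have happly := hU.apply_radius (Ioo_subset_Icc_self hy)
  refine ⟨hmem.1.lt_of_ne fun h => ?_, hmem.2.lt_of_ne fun h => ?_⟩
  · rw [← h] at happly
    rcases min_lt_iff.1 hy.1 with h₁ | h₁ <;> rcases lt_max_iff.1 hy.2 with h₂ | h₂ <;> linarith
  · rw [h] at happly
    rcases min_lt_iff.1 hy.1 with h₁ | h₁ <;> rcases lt_max_iff.1 hy.2 with h₂ | h₂ <;> linarith

theorem mul_dist_le_dist (hU : IsAngularVelocity r₁ r₂ U) {ε m : ℝ} (hε : |ε| = 1)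
    (hm : ∀ x ∈ Icc r₁ r₂, m ≤ ε * derivWithin U (Icc r₁ r₂) x) {x z : ℝ} (hx : x ∈ Icc r₁ r₂)
    (hz : z ∈ Icc r₁ r₂) : m * dist x z ≤ dist (U x) (U z) := by
  wlog hzx : z ≤ x generalizing x z
  · rw [dist_comm x, dist_comm (U x)]
    exact this hz hx (le_of_not_ge hzx)
  have hderiv : ∀ y ∈ interior (Icc r₁ r₂),
      HasDerivAt (fun x => ε * U x) (ε * derivWithin U (Icc r₁ r₂) y) y := fun y hy =>
    (hU.hasDerivAt (interior_Icc.subset hy)).const_mul ε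
  have hmean : m * (x - z) ≤ ε * U x - ε * U z :=
    (convex_Icc r₁ r₂).mul_sub_le_image_sub_of_le_deriv
      (hU.differentiableOn.continuousOn.const_mul ε)
      (fun y hy => (hderiv y hy).differentiableAt.differentiableWithinAt)
      (fun y hy => (hm y (interior_subset hy)).trans_eq (hderiv y hy).deriv.symm) z hz x hx hzx
  calc m * dist x z = m * (x - z) := by rw [Real.dist_eq, abs_of_nonneg (sub_nonneg.2 hzx)]
    _ ≤ |ε * U x - ε * U z| := hmean.trans (le_abs_self _)
    _ = dist (U x) (U z) := by rw [← mul_sub, abs_mul, hε, one_mul, Real.dist_eq]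

theorem lipschitzOnWith_radius (hU : IsAngularVelocity r₁ r₂ U) :
    ∃ K : ℝ≥0, LipschitzOnWith K (radius r₁ r₂ U) (Icc (leftEnd r₁ r₂ U) (rightEnd r₁ r₂ U)) := by
  obtain ⟨ε, m, M, hε, hm, -, hmM⟩ := hU.exists_deriv_bounds
  refine ⟨m⁻¹.toNNReal, LipschitzOnWith.of_dist_le_mul fun y hy z hz => ?_⟩
  have hexpand := hU.mul_dist_le_dist hε (fun x hx => (hmM x hx).1) (hU.radius_mem hy)
    (hU.radius_mem hz)
  rw [hU.apply_radius hy, hU.apply_radius hz] at hexpand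
  rwa [Real.coe_toNNReal _ (inv_nonneg.2 hm.le), inv_mul_eq_div, le_div_iff₀' hm]

theorem hasDerivAt_radius (hU : IsAngularVelocity r₁ r₂ U) {y : ℝ}
    (hy : y ∈ Ioo (leftEnd r₁ r₂ U) (rightEnd r₁ r₂ U)) :
    HasDerivAt (radius r₁ r₂ U) (gCoeff r₁ r₂ U y)⁻¹ y := by
  obtain ⟨K, hK⟩ := hU.lipschitzOnWith_radius
  have hnhds := Icc_mem_nhds hy.1 hy.2
  have hmem := hU.radius_mem_Ioo hy
  refine HasDerivAt.of_local_left_inverse (hK.continuousOn.continuousAt hnhds)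
    (hU.hasDerivAt hmem) (hU.deriv_ne_zero _ (Ioo_subset_Icc_self hmem)) ?_
  filter_upwards [hnhds] with z hz using hU.apply_radius hz

theorem lipschitzOnWith_radius_div_gCoeff (hU : IsAngularVelocity r₁ r₂ U) :
    ∃ K : ℝ≥0, LipschitzOnWith K (fun y => radius r₁ r₂ U y / gCoeff r₁ r₂ U y)
      (Icc (leftEnd r₁ r₂ U) (rightEnd r₁ r₂ U)) := by
  obtain ⟨ε, m, M, hε, hm, -, hmM⟩ := hU.exists_deriv_bounds
  obtain ⟨K₁, hK₁⟩ := hU.lipschitzOnWith_radius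
  obtain ⟨K₂, hK₂⟩ := hU.lipschitz_deriv
  have hdiv : ContDiffOn ℝ 1 (fun p : ℝ × ℝ => ε * (p.1 / p.2)) (Icc r₁ r₂ ×ˢ Icc m M) :=
    contDiffOn_const.mul (contDiffOn_fst.div contDiffOn_snd fun p hp =>
      (hm.trans_le hp.2.1).ne')
  obtain ⟨K₃, hK₃⟩ := hdiv.exists_lipschitzOnWith one_ne_zero
    ((convex_Icc _ _).prod (convex_Icc _ _)) (isCompact_Icc.prod isCompact_Icc)
  have hpair := (LipschitzWith.id.lipschitzOnWith (s := Icc r₁ r₂)).prodMk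
    ((lipschitzWith_smul ε).comp_lipschitzOnWith hK₂)
  have hcomp := (hK₃.comp hpair fun x hx => ⟨hx, hmM x hx⟩).comp hK₁ fun y hy => hU.radius_mem hy
  have hε₀ : ε ≠ 0 := abs_pos.1 (hε.symm ▸ one_pos)
  refine ⟨K₃ * max 1 (‖ε‖₊ * K₂) * K₁, fun x hx y hy => ?_⟩
  simpa only [gCoeff, Function.comp_apply, id_eq, smul_eq_mul, mul_div_assoc',
    mul_div_mul_left _ _ hε₀] using hcomp hx hy

theorem exists_isStreamCoefficient (hU : IsAngularVelocity r₁ r₂ U) :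
    ∃ ε c R₀ R₁ : ℝ, IsStreamCoefficient (leftEnd r₁ r₂ U) (rightEnd r₁ r₂ U) (gCoeff r₁ r₂ U)
      (radius r₁ r₂ U) ε c R₀ R₁ := by
  obtain ⟨ε, m, M, hε, hm, hM, hmM⟩ := hU.exists_deriv_bounds
  obtain ⟨K₁, hK₁⟩ := hU.lipschitzOnWith_radius
  obtain ⟨K₂, hK₂⟩ := hU.lipschitzOnWith_radius_div_gCoeff
  have hab := hU.leftEnd_lt_rightEnd.le
  have hr₁ := hU.pos
  have hr₂ := hU.pos.trans hU.lt
  have hK₁' := Complex.isometry_ofReal.lipschitz.comp_lipschitzOnWith hK₁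
  have hK₂' := Complex.isometry_ofReal.lipschitz.comp_lipschitzOnWith hK₂
  obtain ⟨R₀, hR₀⟩ := isCompact_Icc.exists_bound_of_continuousOn hK₂'.continuousOn
  have hIcc := (ae_mem_Ioo (leftEnd r₁ r₂ U) (rightEnd r₁ r₂ U)).mono
    fun y hy => Ioo_subset_Icc_self hy
  exact ⟨ε, min (r₁ * m) (r₂ * M)⁻¹, R₀, _,
    { isH1_radius := isH1_of_lipschitzOnWith hab hK₁'
      deriv_radius := (ae_mem_Ioo _ _).mono fun y hy => (hU.hasDerivAt_radius hy).ofReal_comp.deriv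
      abs_sign := hε
      pos := by positivity
      le_mul := hIcc.mono fun y hy => by
        have hr := hU.radius_mem hy
        rw [mul_left_comm]
        exact (min_le_left _ _).trans
          (mul_le_mul hr.1 (hmM _ hr).1 hm.le (hr₁.le.trans hr.1))
      mul_le := hIcc.mono fun y hy => by
        have hr := hU.radius_mem hy
        rw [mul_left_comm]
        refine (mul_le_mul hr.2 (hmM _ hr).2 (hm.le.trans (hmM _ hr).1) hr₂.le).trans ?_
        exact le_inv_of_le_inv₀ (by positivity) (min_le_right _ _)
      isH1_div := isH1_of_lipschitzOnWith hab hK₂'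
      zero_le_bound := (norm_nonneg _).trans (hR₀ _ (left_mem_Icc.2 hab))
      zero_le_derivBound := NNReal.coe_nonneg _
      norm_div_le := hIcc.mono hR₀
      norm_deriv_div_le := ae_norm_deriv_le_of_lipschitzOnWith hK₂' }⟩

theorem exists_isEllipticConstant (hU : IsAngularVelocity r₁ r₂ U) {κ : ℝ} (hκ : 0 < κ) :
    ∃ K : ℝ, 0 < K ∧ ∀ k : ℝ, κ ≤ |k| →
      IsEllipticConstant (leftEnd r₁ r₂ U) (rightEnd r₁ r₂ U) (gCoeff r₁ r₂ U) (radius r₁ r₂ U)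
        k K := by
  obtain ⟨ε, c, R₀, R₁, hgr⟩ := hU.exists_isStreamCoefficient
  have hc := hgr.pos
  have hR₀ := hgr.zero_le_bound
  have hR₁ := hgr.zero_le_derivBound
  refine ⟨(R₀ + κ⁻¹ * R₁) / c + 1, by positivity, fun k hk t w Φ hΦ => ?_⟩
  have hk₀ : k ≠ 0 := abs_pos.1 (hκ.trans_le hk)
  refine (hgr.isEllipticConstant hU.leftEnd_lt_rightEnd hk₀ t w Φ hΦ).trans
    (mul_le_mul_of_nonneg_right ?_ (hTildeNegNorm_nonneg ..))
  calc (R₀ + |k|⁻¹ * R₁) / c ≤ (R₀ + κ⁻¹ * R₁) / c := by gcongr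
    _ ≤ (R₀ + κ⁻¹ * R₁) / c + 1 := by linarith

end IsAngularVelocity

end AngularVelocity

section Evolution

variable {a b k t C C₂ δ : ℝ} {g r : ℝ → ℝ} {h : ℝ → ℂ} {J : Set ℝ} {W : ℝ → L2 a b}

theorem ae_norm_le_supNorm {f : ℝ → ℂ} (hf : MemLp f ∞ (intervalMeasure a b)) :
    ∀ᵐ y ∂(intervalMeasure a b), ‖f y‖ ≤ supNorm a b f := by
  filter_upwards [ae_le_eLpNormEssSup (f := f) (μ := intervalMeasure a b)] with y hy
  rw [← eLpNorm_exponent_top] at hy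
  rw [← toReal_enorm]
  exact ENNReal.toReal_mono hf.2.ne hy

/-- The smallness parameter of the forcing: the `W^{1,∞}` norm of `h` in which derivatives are
weighted by `1 / k`, divided by `k`. -/
noncomputable def forcingSize (a b k : ℝ) (h : ℝ → ℂ) : ℝ :=
  |k|⁻¹ * (supNorm a b h + |k|⁻¹ * supNorm a b (deriv h))

theorem forcingSize_nonneg (a b k : ℝ) (h : ℝ → ℂ) : 0 ≤ forcingSize a b k h := by
  have : 0 ≤ supNorm a b h := ENNReal.toReal_nonneg
  have : 0 ≤ supNorm a b (deriv h) := ENNReal.toReal_nonneg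
  unfold forcingSize
  positivity

theorem norm_inner_forcing_le (hab : a < b) (hk : k ≠ 0) (t : ℝ) {K : ℝ≥0}
    (hh : LipschitzOnWith K h (Icc a b)) {Φ : ℝ → ℂ} (hΦ : IsH10 a b Φ) {V : L2 a b}
    (hV : ∀ᵐ y ∂(intervalMeasure a b), V y = Complex.I * h y / (k : ℂ) * Φ y) (u : L2 a b) :
    ‖(inner ℂ V u : ℂ)‖ ≤
      forcingSize a b k h * hTildeNorm a b k t Φ * hTildeNegNorm a b k t u := by
  have hh₁ := isH1_of_lipschitzOnWith hab.le hh
  have hderiv := memLp_top_of_bound hh₁.1.aestronglyMeasurable K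
    (ae_norm_deriv_le_of_lipschitzOnWith hh)
  have hmul := hTildeNorm_mul_le hab.le hh₁ hΦ.1 k t ENNReal.toReal_nonneg ENNReal.toReal_nonneg
    (ae_norm_le_supNorm (hh₁.memLp_top hab.le)) (ae_norm_le_supNorm hderiv)
  have hdual := norm_integral_conj_mul_le hab hk t (Lp.memLp u) (hΦ.mul_left hab.le hh₁)
  have hinner : (inner ℂ V u : ℂ) = star (Complex.I / (k : ℂ)) *
      ∫ y, star (h y * Φ y) * u y ∂(intervalMeasure a b) := by
    rw [L2.inner_def, ← integral_const_mul]
    refine integral_congr_ae ?_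
    filter_upwards [hV] with y hy
    rw [RCLike.inner_apply', hy]
    simp only [RCLike.star_def, map_mul, map_div₀]
    ring
  calc ‖(inner ℂ V u : ℂ)‖
      = |k|⁻¹ * ‖∫ y, star (h y * Φ y) * u y ∂(intervalMeasure a b)‖ := by
        rw [hinner, norm_mul, norm_star, norm_div, Complex.norm_I, Complex.norm_real,
          Real.norm_eq_abs, one_div]
    _ ≤ |k|⁻¹ * ((supNorm a b h + |k|⁻¹ * supNorm a b (deriv h)) * hTildeNorm a b k t Φ *
          hTildeNegNorm a b k t u) := by
        gcongr
        exact hdual.trans (mul_le_mul_of_nonneg_right hmul (hTildeNegNorm_nonneg ..))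
    _ = _ := by
        rw [forcingSize]
        ring

theorem IsScatteringSolution.exists_hasDerivWithinAt_weightForm
    (hW : IsScatteringSolution a b g r h k J W) (hab : a < b) (hk : k ≠ 0) (hC₂ : 0 < C₂)
    (hweight : IsWeightConstant a b k C₂) (hC : 0 < C)
    (helliptic : IsEllipticConstant a b g r k (C / 2)) {K : ℝ≥0}
    (hh : LipschitzOnWith K h (Icc a b))
    (hsmall : forcingSize a b k h ≤ 1 / C * (1 / C₂ - δ)) (ht : t ∈ J) :
    ∃ I' : ℝ, HasDerivWithinAt (fun s => weightForm a b k s (W s)) I' J t ∧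
      I' ≤ -δ * hTildeNegNorm a b k t (W t) * hTildeNegNorm a b k t (weightOp a b k t (W t)) := by
  obtain ⟨Φ, V, hΦ, hV, hderiv⟩ := hW t ht
  refine ⟨_, hasDerivWithinAt_weightForm hab k hderiv, ?_⟩
  have hforcing := norm_inner_forcing_le hab hk t hh hΦ.1 hV (weightOp a b k t (W t))
  have hΦW := helliptic t (W t) Φ hΦ
  have hdissipation := hweight t (W t)
  rw [(hasDerivAt_weightForm hab k t (W t)).deriv, neg_mul_neg, ← div_le_iff₀' hC₂]
    at hdissipation
  have hS := (forcingSize_nonneg a b k h).trans hsmall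
  have hΦ_nonneg := hTildeNorm_nonneg a b k t Φ
  have hn := hTildeNegNorm_nonneg a b k t (W t)
  have hn' := hTildeNegNorm_nonneg a b k t (weightOp a b k t (W t))
  set n := hTildeNegNorm a b k t (W t)
  set n' := hTildeNegNorm a b k t (weightOp a b k t (W t))
  have hwork : (inner ℂ V (weightOp a b k t (W t)) : ℂ).re ≤ (1 / C₂ - δ) / 2 * (n * n') :=
    calc (inner ℂ V (weightOp a b k t (W t)) : ℂ).re
        ≤ forcingSize a b k h * hTildeNorm a b k t Φ * n' :=
          (Complex.re_le_norm _).trans hforcing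
      _ ≤ 1 / C * (1 / C₂ - δ) * (C / 2 * n) * n' := by gcongr
      _ = _ := by field_simp
  linarith [div_eq_mul_one_div (n * n') C₂]

theorem exp_neg_pi_mul_sq_norm_le_weightForm (hab : a < b) (k t : ℝ) (u : L2 a b) :
    Real.exp (-Real.pi) * ‖u‖ ^ 2 ≤ weightForm a b k t u := by
  refine le_trans ?_ (le_weightForm hab k t u)
  gcongr
  linarith [Real.pi_pos]

theorem weightForm_le_exp_pi_mul_sq_norm (hab : a < b) (k t : ℝ) (u : L2 a b) :
    weightForm a b k t u ≤ Real.exp Real.pi * ‖u‖ ^ 2 := by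
  refine (weightForm_le hab k t u).trans ?_
  gcongr
  linarith [Real.pi_pos]

theorem norm_le_of_weightForm_le (hab : a < b) {s : ℝ} {u v : L2 a b}
    (huv : weightForm a b k t u ≤ weightForm a b k s v) : ‖u‖ ≤ Real.exp Real.pi * ‖v‖ := by
  refine le_of_sq_le_sq ?_ (by positivity)
  refine le_of_mul_le_mul_left ?_ (Real.exp_pos (-Real.pi))
  calc Real.exp (-Real.pi) * ‖u‖ ^ 2 ≤ Real.exp Real.pi * ‖v‖ ^ 2 :=
        (exp_neg_pi_mul_sq_norm_le_weightForm hab k t u).trans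
          (huv.trans (weightForm_le_exp_pi_mul_sq_norm hab k s v))
    _ = Real.exp (-Real.pi) * (Real.exp Real.pi * ‖v‖) ^ 2 := by
        rw [mul_pow, ← mul_assoc, sq (Real.exp _), ← mul_assoc, ← Real.exp_add, neg_add_cancel,
          Real.exp_zero, one_mul]

theorem antitoneOn_of_exists_hasDerivWithinAt_nonpos {f : ℝ → ℝ} (hJ : J.OrdConnected)
    (hf : ∀ t ∈ J, ∃ f', HasDerivWithinAt f f' J t ∧ f' ≤ 0) : AntitoneOn f J := by
  choose! f' hf' hf'_nonpos using hf
  exact antitoneOn_of_hasDerivWithinAt_nonpos hJ.convex (fun t ht => (hf' t ht).continuousWithinAt)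
    (fun t ht => (hf' t (interior_subset ht)).mono interior_subset)
    fun t ht => hf'_nonpos t (interior_subset ht)

theorem IsWaveNumber.one_le_abs (hk : IsWaveNumber k) : 1 ≤ |k| := by
  obtain ⟨m, hm, rfl⟩ := hk
  have hm₁ : (1 : ℝ) ≤ |(m : ℝ)| := by exact_mod_cast Int.one_le_abs hm
  have hπ : (1 : ℝ) ≤ 2 * Real.pi := by linarith [Real.pi_gt_three]
  rw [abs_mul, abs_of_pos Real.two_pi_pos]
  exact one_le_mul_of_one_le_of_one_le hπ hm₁

theorem IsWaveNumber.ne_zero (hk : IsWaveNumber k) : k ≠ 0 :=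
  abs_pos.1 (one_pos.trans_le hk.one_le_abs)

end Evolution

end EulerScattering

theorem theorem3p6_general :
    (∃ C₂ : ℝ, Real.exp (-Real.pi) ≤ C₂ ∧ C₂ ≤ Real.exp Real.pi ∧
      ∀ a b : ℝ, a < b → ∀ k : ℝ, k ≠ 0 → IsWeightConstant a b k C₂) ∧
    (∀ (r₁ r₂ : ℝ) (U : ℝ → ℝ), IsAngularVelocity r₁ r₂ U → ∀ κ : ℝ, 0 < κ →
      ∃ C : ℝ, 0 < C ∧ ∀ k : ℝ, κ ≤ |k| →
        IsEllipticConstant (leftEnd r₁ r₂ U) (rightEnd r₁ r₂ U) (gCoeff r₁ r₂ U) (radius r₁ r₂ U)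
          k (C / 2)) ∧
    ∀ (a b : ℝ) (g r : ℝ → ℝ), a < b → ∀ k : ℝ, k ≠ 0 →
      ∀ C₂ : ℝ, 0 < C₂ → IsWeightConstant a b k C₂ →
      ∀ C : ℝ, 0 < C → IsEllipticConstant a b g r k (C / 2) →
      ∀ h : ℝ → ℂ, (∃ K : ℝ≥0, LipschitzOnWith K h (Icc a b)) →
      ∀ δ : ℝ, 0 ≤ δ →
      |k|⁻¹ * (supNorm a b h + |k|⁻¹ * supNorm a b (deriv h)) ≤ 1 / C * (1 / C₂ - δ) →
      ∀ J : Set ℝ, J.OrdConnected →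
      ∀ W : ℝ → L2 a b, IsScatteringSolution a b g r h k J W →
        AntitoneOn (fun t => weightForm a b k t (W t)) J ∧
        (∀ t ∈ J, ∃ I' : ℝ,
          HasDerivWithinAt (fun s => weightForm a b k s (W s)) I' J t ∧
          I' ≤ -δ * hTildeNegNorm a b k t (W t) *
            hTildeNegNorm a b k t (weightOp a b k t (W t)) ∧
          -δ * hTildeNegNorm a b k t (W t) *
            hTildeNegNorm a b k t (weightOp a b k t (W t)) ≤ 0) ∧
        (0 ∈ J → ∀ t ∈ J, 0 ≤ t →
          Real.exp (-Real.pi) * ‖W t‖ ^ 2 ≤ weightForm a b k t (W t) ∧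
          weightForm a b k t (W t) ≤ weightForm a b k 0 (W 0) ∧
          weightForm a b k 0 (W 0) ≤ Real.exp Real.pi * ‖W 0‖ ^ 2 ∧
          ‖W t‖ ≤ Real.exp Real.pi * ‖W 0‖) := by
  refine ⟨⟨Real.exp (Real.pi / 2), by gcongr; linarith [Real.pi_pos],
    by gcongr; linarith [Real.pi_pos], fun a b hab k hk => isWeightConstant_exp_pi_div_two hab hk⟩,
    fun r₁ r₂ U hU κ hκ => ?_, ?_⟩
  · obtain ⟨K, hK₀, hK⟩ := hU.exists_isEllipticConstant hκ
    exact ⟨2 * K, by positivity, by simpa only [mul_div_cancel_left₀ K two_ne_zero] using hK⟩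
  · rintro a b g r hab k hk C₂ hC₂ hweight C hC helliptic h ⟨K, hh⟩ δ hδ hsmall J hJ W hW
    have hderiv := fun t ht => hW.exists_hasDerivWithinAt_weightForm hab hk hC₂ hweight hC
      helliptic hh hsmall (t := t) ht
    have hneg : ∀ t, -δ * hTildeNegNorm a b k t (W t) *
        hTildeNegNorm a b k t (weightOp a b k t (W t)) ≤ 0 := fun t =>
      mul_nonpos_of_nonpos_of_nonneg (mul_nonpos_of_nonpos_of_nonneg (neg_nonpos.2 hδ)
        (hTildeNegNorm_nonneg ..)) (hTildeNegNorm_nonneg ..)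
    have hanti := antitoneOn_of_exists_hasDerivWithinAt_nonpos hJ fun t ht =>
      (hderiv t ht).imp fun _ hI => ⟨hI.1, hI.2.trans (hneg t)⟩
    exact ⟨hanti, fun t ht => (hderiv t ht).imp fun _ hI => ⟨hI.1, hI.2, hneg t⟩,
      fun h0 t ht h0t => ⟨exp_neg_pi_mul_sq_norm_le_weightForm hab k t (W t), hanti h0 ht h0t,
        weightForm_le_exp_pi_mul_sq_norm hab k 0 (W 0),
        norm_le_of_weightForm_le hab (hanti h0 ht h0t)⟩⟩

theorem theorem3p6 :
    -- existence of the absolute constant `C₂`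
    (∃ C₂ : ℝ, Real.exp (-Real.pi) ≤ C₂ ∧ C₂ ≤ Real.exp Real.pi ∧
      ∀ a b : ℝ, a < b → ∀ k : ℝ, IsWaveNumber k → IsWeightConstant a b k C₂) ∧
    ∀ (r₁ r₂ : ℝ) (U : ℝ → ℝ), IsAngularVelocity r₁ r₂ U →
      ∀ (a b : ℝ) (g r : ℝ → ℝ), a = leftEnd r₁ r₂ U → b = rightEnd r₁ r₂ U →
        g = gCoeff r₁ r₂ U → r = radius r₁ r₂ U →
      -- existence of the constant `C`, uniform in `k` and `t`
      (∃ C : ℝ, 0 < C ∧ ∀ k : ℝ, IsWaveNumber k → IsEllipticConstant a b g r k (C / 2)) ∧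
      -- stability, for all admissible constants
      ∀ k : ℝ, IsWaveNumber k →
      ∀ C₂ : ℝ, 0 < C₂ → IsWeightConstant a b k C₂ →
      ∀ C : ℝ, 0 < C → IsEllipticConstant a b g r k (C / 2) →
      ∀ h : ℝ → ℂ, (∃ K : ℝ≥0, LipschitzOnWith K h (Icc a b)) →
      ∀ δ : ℝ, 0 < δ →
      |k|⁻¹ * (supNorm a b h + |k|⁻¹ * supNorm a b (deriv h)) ≤ 1 / C * (1 / C₂ - δ) →
      ∀ J : Set ℝ, J.OrdConnected → J.Nontrivial →
      ∀ W : ℝ → L2 a b, IsScatteringSolution a b g r h k J W →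
        AntitoneOn (fun t => weightForm a b k t (W t)) J ∧
        (∀ t ∈ J, ∃ I' : ℝ,
          HasDerivWithinAt (fun s => weightForm a b k s (W s)) I' J t ∧
          I' ≤ -δ * hTildeNegNorm a b k t (W t) *
            hTildeNegNorm a b k t (weightOp a b k t (W t)) ∧
          -δ * hTildeNegNorm a b k t (W t) *
            hTildeNegNorm a b k t (weightOp a b k t (W t)) ≤ 0) ∧
        (0 ∈ J → ∀ t ∈ J, 0 ≤ t →
          Real.exp (-Real.pi) * ‖W t‖ ^ 2 ≤ weightForm a b k t (W t) ∧
          weightForm a b k t (W t) ≤ weightForm a b k 0 (W 0) ∧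
          weightForm a b k 0 (W 0) ≤ Real.exp Real.pi * ‖W 0‖ ^ 2 ∧
          ‖W t‖ ≤ Real.exp Real.pi * ‖W 0‖) := by
  obtain ⟨⟨C₂, hC₂_ge, hC₂_le, hweight⟩, hellipticExists, hstability⟩ := theorem3p6_general
  refine ⟨⟨C₂, hC₂_ge, hC₂_le, fun a b hab k hk => hweight a b hab k hk.ne_zero⟩, ?_⟩
  rintro r₁ r₂ U hU _ _ _ _ rfl rfl rfl rfl
  obtain ⟨C, hC, helliptic⟩ := hellipticExists r₁ r₂ U hU 1 one_pos
  exact ⟨⟨C, hC, fun k hk => helliptic k hk.one_le_abs⟩,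
    fun k hk C₂ hC₂ hw C hC he h hh δ hδ hsmall J hJ _ =>
      hstability _ _ _ _ hU.leftEnd_lt_rightEnd k hk.ne_zero C₂ hC₂ hw C hC he h hh δ hδ.le
        hsmall J hJ⟩
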